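/- Let $\mathcal{G}\rightrightarrows M$ be a (finite-dimensional, smooth) Lie groupoid with source $s$, target $t$, units $x\mapsto 1_x$ and inversion $\mathrm{inv}$, where $gh$ is defined iff $s(g)=t(h)$. Let $A$ be its Lie algebroid, $A_x=\ker(ds\colon T_{1_x}\mathcal{G}\to T_xM)$, so that $T_{1_x}\mathcal{G}=T_xM\oplus A_x$, where $T_xM$ is embedded by the differential of the unit map. For $u\in A_{t(g)}$ put $\overrightarrow{u}(g)=dR_g(u)$, and for $u\in A_{s(g)}$ put $\overleftarrow{u}(g)=-dL_g(d\,\mathrm{inv}(u))$, with $R_g(h)=hg$, $L_g(h)=gh$. For a section $\pi$ of $\wedge^kA$ let $\overrightarrow{\pi}$ and $\overleftarrow{\pi}$ be the sections of $\wedge^kT\mathcal{G}$ obtained by applying to $\pi_{t(g)}$, respectively $\pi_{s(g)}$, the $k$-th exterior power of the linear map $u\mapsto\overrightarrow{u}(g)$, respectively $u\mapsto\overleftarrow{u}(g)$. A submanifold $S$ of a manifold $X$ is coisotropic with respect to a $k$-vector field $\Pi$ on $X$ if $\Pi_x(\xi_1,\dots,\xi_k)=0$ for all $x\in S$ and all $\xi_1,\dots,\xi_k\in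 T_x^*X$ that vanish on $T_xS$. A $k$-vector field $\Pi$ on $\mathcal{G}$ is affine if $\{(g,h,l,hg^{-1}l): s(g)=s(h),\ t(g)=t(l)\}\subset\mathcal{G}^4$ is coisotropic with respect to $\Pi\oplus(-1)^{k+1}\Pi\oplus(-1)^{k+1}\Pi\oplus\Pi$, and multiplicative if $\{(g,h,gh): s(g)=t(h)\}\subset\mathcal{G}^3$ is coisotropic with respect to $\Pi\oplus\Pi\oplus(-1)^{k+1}\Pi$. Proposition. Let $k\ge 0$, let $\Pi$ be a smooth $k$-vector field on $\mathcal{G}$, let $\pi=\mathrm{pr}_{\wedge^kA}(\Pi|_M)$ be its $\wedge^kA$-component along $M$, with respect to $T\mathcal{G}|_M=TM\oplus A$, and put $$\Pi_r=\Pi-\overrightarrow{\pi},\qquad \Pi_l=\Pi-\overleftarrow{\pi}.$$ Then $\Pi_r$ and $\Pi_l$ are smooth $k$-vector fields on $\mathcal{G}$; $\Pi$ is affine if and only if $\Pi_r$ is multiplicative; and $\Pi$ is affine if and only if $\Pi_l$ is multiplicative. -/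

import Mathlib

open scoped Manifold ContDiff Topology

noncomputable section

/-! ### Multivector fields and coisotropic subsets -/

section Multivector

/-- The value `P(ξ₁, …, ξₖ)` of a `k`-vector `P ∈ ⋀ᵏ V` on covectors, normalised by
`(v₁ ∧ ⋯ ∧ vₖ)(ξ₁, …, ξₖ) = det (ξⱼ(vᵢ))`. -/
def kvectorEval {V : Type*} [AddCommGroup V] [Module ℝ V] {k : ℕ} (P : ⋀[ℝ]^k V)
    (ξ : Fin k → Module.Dual ℝ V) : ℝ :=
  exteriorPower.alternatingMapToDual ℝ V k ξ P

/-- A subspace `W ⊆ V` is coisotropic with respect to `P ∈ ⋀ᵏ V` if `P` vanishes on every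
`k`-tuple of covectors from the annihilator of `W`. -/
def IsCoisotropicSubspace {V : Type*} [AddCommGroup V] [Module ℝ V] {k : ℕ}
    (W : Submodule ℝ V) (P : ⋀[ℝ]^k V) : Prop :=
  ∀ ξ : Fin k → Module.Dual ℝ V, (∀ i, ξ i ∈ W.dualAnnihilator) → kvectorEval P ξ = 0

variable {E : Type*} [NormedAddCommGroup E] [NormedSpace ℝ E]
  {H : Type*} [TopologicalSpace H] (I : ModelWithCorners ℝ E H)
  (X : Type*) [TopologicalSpace X] [ChartedSpace H X]
  {E' : Type*} [NormedAddCommGroup E'] [NormedSpace ℝ E']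
  {H' : Type*} [TopologicalSpace H'] (I' : ModelWithCorners ℝ E' H')
  (Y : Type*) [TopologicalSpace Y] [ChartedSpace H' Y]

/-- Not necessarily smooth sections of `⋀ᵏ TX`; smoothness is `IsSmoothKVectorField`. -/
abbrev KVectorField (k : ℕ) : Type _ := ∀ x : X, ⋀[ℝ]^k (TangentSpace I x)

variable {X Y}

/-- A section of `⋀ᵏ TX` is smooth if near every point its components in the local trivialization
of `⋀ᵏ TX` induced by a chart are smooth functions. Here `X` is finite-dimensional, and the
components are obtained by applying the linear functionals on `⋀ᵏ E`. -/
def IsSmoothKVectorField [IsManifold I ∞ X] {k : ℕ} (P : KVectorField I X k) : Prop :=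
  ∀ (x₀ : X) (φ : Module.Dual ℝ (⋀[ℝ]^k E)),
    ContMDiffAt I 𝓘(ℝ, ℝ) ∞
      (fun x : X => φ (exteriorPower.map k
        ((trivializationAt E (TangentSpace I : X → Type _) x₀).continuousLinearMapAt ℝ x).toLinearMap
        (P x))) x₀

/-- The inclusion `T_x X → T_(x,y)(X × Y)`, the differential of `x' ↦ (x', y)` at `x`. -/
def tangentInl (p : X × Y) : TangentSpace I p.1 →L[ℝ] TangentSpace (I.prod I') p :=
  mfderiv I (I.prod I') (fun x : X => (x, p.2)) p.1

/-- The inclusion `T_y Y → T_(x,y)(X × Y)`, the differential of `y' ↦ (x, y')` at `y`. -/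
def tangentInr (p : X × Y) : TangentSpace I' p.2 →L[ℝ] TangentSpace (I.prod I') p :=
  mfderiv I' (I.prod I') (fun y : Y => (p.1, y)) p.2

/-- The direct sum `P ⊕ Q` on `X × Y`, with value `P x + Q y` at `(x, y)` under
`T_(x,y)(X × Y) = T_x X ⊕ T_y Y`. -/
def KVectorField.directSum {k : ℕ} (P : KVectorField I X k) (Q : KVectorField I' Y k) :
    KVectorField (I.prod I') (X × Y) k :=
  fun p => exteriorPower.map k (tangentInl I I' p).toLinearMap (P p.1) +
    exteriorPower.map k (tangentInr I I' p).toLinearMap (Q p.2)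

/-- The tangent space at `x` of a submanifold `S` of a manifold without boundary: it is spanned by
(and for a submanifold consists of) the velocities at `x` of smooth curves that run in `S`. -/
def tangentSpaceOfSubset (S : Set X) (x : X) : Submodule ℝ (TangentSpace I x) :=
  Submodule.span ℝ {v | ∃ γ : ℝ → X, ∃ h : γ 0 = x, ContMDiffAt 𝓘(ℝ, ℝ) I ∞ γ 0 ∧
    (∀ᶠ τ in 𝓝 (0 : ℝ), γ τ ∈ S) ∧
    v = h ▸ (mfderiv 𝓘(ℝ, ℝ) I γ 0 (1 : ℝ) : TangentSpace I (γ 0))}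

/-- A submanifold `S` is coisotropic with respect to the `k`-vector field `P`. -/
def IsCoisotropic {k : ℕ} (S : Set X) (P : KVectorField I X k) : Prop :=
  ∀ x ∈ S, IsCoisotropicSubspace (tangentSpaceOfSubset I S x) (P x)

end Multivector

/-! ### Lie groupoids -/

/-- A Lie groupoid `G ⇉ M`, where `G` and `M` are smooth manifolds modelled on `EG` and `EM`.
The product `mul g h` is meaningful only if `src g = tgt h`; its values on other pairs are
irrelevant. -/
structure LieGroupoid (EG : Type*) [NormedAddCommGroup EG] [NormedSpace ℝ EG]
    (EM : Type*) [NormedAddCommGroup EM] [NormedSpace ℝ EM]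
    (G : Type*) [TopologicalSpace G] [ChartedSpace EG G]
    (M : Type*) [TopologicalSpace M] [ChartedSpace EM M] where
  src : G → M
  tgt : G → M
  unit : M → G
  inv : G → G
  mul : G → G → G
  src_unit : ∀ x, src (unit x) = x
  tgt_unit : ∀ x, tgt (unit x) = x
  src_inv : ∀ g, src (inv g) = tgt g
  tgt_inv : ∀ g, tgt (inv g) = src g
  src_mul : ∀ g h, src g = tgt h → src (mul g h) = src h
  tgt_mul : ∀ g h, src g = tgt h → tgt (mul g h) = tgt g
  mul_assoc : ∀ g h l, src g = tgt h → src h = tgt l → mul (mul g h) l = mul g (mul h l)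
  unit_mul : ∀ g, mul (unit (tgt g)) g = g
  mul_unit : ∀ g, mul g (unit (src g)) = g
  inv_mul : ∀ g, mul (inv g) g = unit (src g)
  mul_inv : ∀ g, mul g (inv g) = unit (tgt g)
  isSubmersion_src : Manifold.IsSubmersion 𝓘(ℝ, EG) 𝓘(ℝ, EM) ∞ src
  isSubmersion_tgt : Manifold.IsSubmersion 𝓘(ℝ, EG) 𝓘(ℝ, EM) ∞ tgt
  contMDiff_unit : ContMDiff 𝓘(ℝ, EM) 𝓘(ℝ, EG) ∞ unit
  contMDiff_inv : ContMDiff 𝓘(ℝ, EG) 𝓘(ℝ, EG) ∞ inv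
  contMDiffOn_mul : ContMDiffOn (𝓘(ℝ, EG).prod 𝓘(ℝ, EG)) 𝓘(ℝ, EG) ∞
    (fun p : G × G => mul p.1 p.2) {p | src p.1 = tgt p.2}

namespace LieGroupoid

variable {EG : Type*} [NormedAddCommGroup EG] [NormedSpace ℝ EG]
  {EM : Type*} [NormedAddCommGroup EM] [NormedSpace ℝ EM]
  {G : Type*} [TopologicalSpace G] [ChartedSpace EG G]
  {M : Type*} [TopologicalSpace M] [ChartedSpace EM M]
  (𝒢 : LieGroupoid EG EM G M)

/-- The fibre `A_x = ker (ds : T_{1_x} G → T_x M)` of the Lie algebroid. -/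
def algebroidFiber (x : M) : Submodule ℝ (TangentSpace 𝓘(ℝ, EG) (𝒢.unit x)) :=
  LinearMap.ker (mfderiv 𝓘(ℝ, EG) 𝓘(ℝ, EM) 𝒢.src (𝒢.unit x)).toLinearMap

/-- `ds : T_{1_x} G → T_x M`, using `s(1_x) = x`. -/
def dsrcUnit (x : M) : TangentSpace 𝓘(ℝ, EG) (𝒢.unit x) →L[ℝ] TangentSpace 𝓘(ℝ, EM) x :=
  mfderiv 𝓘(ℝ, EG) 𝓘(ℝ, EM) 𝒢.src (𝒢.unit x)

theorem dsrcUnit_dunit (x : M) (w : TangentSpace 𝓘(ℝ, EM) x) :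
    𝒢.dsrcUnit x (mfderiv 𝓘(ℝ, EM) 𝓘(ℝ, EG) 𝒢.unit x w) = w := by
  have hs : MDifferentiableAt 𝓘(ℝ, EG) 𝓘(ℝ, EM) 𝒢.src (𝒢.unit x) :=
    𝒢.isSubmersion_src.contMDiff.mdifferentiableAt (by simp)
  have hu : MDifferentiableAt 𝓘(ℝ, EM) 𝓘(ℝ, EG) 𝒢.unit x :=
    𝒢.contMDiff_unit.mdifferentiableAt (by simp)
  have h1 := mfderiv_comp x hs hu
  have h2 : 𝒢.src ∘ 𝒢.unit = id := funext 𝒢.src_unit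
  rw [h2, mfderiv_id] at h1
  exact (congrArg (fun L : EM →L[ℝ] EM => L w) h1).symm

/-- The projection `T_{1_x} G = T_x M ⊕ A_x → A_x` along the tangent space of the unit
submanifold `M ⊆ G`, that is, `v ↦ v - d1(ds(v))`. -/
def prA (x : M) : TangentSpace 𝓘(ℝ, EG) (𝒢.unit x) →ₗ[ℝ] 𝒢.algebroidFiber x :=
  LinearMap.codRestrict (𝒢.algebroidFiber x)
    (LinearMap.id - (mfderiv 𝓘(ℝ, EM) 𝓘(ℝ, EG) 𝒢.unit x).toLinearMap ∘ₗ
      (𝒢.dsrcUnit x).toLinearMap)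
    (fun v => by
      change 𝒢.dsrcUnit x (v - mfderiv 𝓘(ℝ, EM) 𝓘(ℝ, EG) 𝒢.unit x (𝒢.dsrcUnit x v)) = 0
      rw [map_sub, dsrcUnit_dunit, sub_self])

/-- The component `π = pr_{⋀ᵏ A} (Π|_M)` of the restriction of `Π` to the unit submanifold. -/
def algebroidComponent {k : ℕ} (P : KVectorField 𝓘(ℝ, EG) G k) (x : M) :
    ⋀[ℝ]^k (𝒢.algebroidFiber x) :=
  exteriorPower.map k (𝒢.prA x) (P (𝒢.unit x))

/-- The differential at the unit `1_{t(g)}` of `R_g : s⁻¹(t(g)) → s⁻¹(s(g))`, `h ↦ h g`. Only its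
restriction to `A_{t(g)}`, the tangent space of `s⁻¹(t(g))` at `1_{t(g)}`, is meaningful. Its values
lie in `T_g G` since `1_{t(g)} g = g`. -/
def dRightFull (g : G) :
    TangentSpace 𝓘(ℝ, EG) (𝒢.unit (𝒢.tgt g)) →L[ℝ] TangentSpace 𝓘(ℝ, EG) g :=
  mfderivWithin 𝓘(ℝ, EG) 𝓘(ℝ, EG) (fun h => 𝒢.mul h g) {h | 𝒢.src h = 𝒢.tgt g}
    (𝒢.unit (𝒢.tgt g))

/-- The linear map `dR_g : A_{t(g)} → T_g G`. -/
def dRight (g : G) : 𝒢.algebroidFiber (𝒢.tgt g) →ₗ[ℝ] TangentSpace 𝓘(ℝ, EG) g :=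
  (𝒢.dRightFull g).toLinearMap ∘ₗ (𝒢.algebroidFiber (𝒢.tgt g)).subtype

/-- The differential of the inversion `T_{1_x} G → T_{1_x} G`, using `inv 1_x = 1_x`. -/
def dinvUnit (x : M) :
    TangentSpace 𝓘(ℝ, EG) (𝒢.unit x) →L[ℝ] TangentSpace 𝓘(ℝ, EG) (𝒢.unit x) :=
  mfderiv 𝓘(ℝ, EG) 𝓘(ℝ, EG) 𝒢.inv (𝒢.unit x)

/-- The differential at the unit `1_{s(g)}` of `L_g : t⁻¹(s(g)) → t⁻¹(t(g))`, `h ↦ g h`. Only its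
restriction to the tangent space of `t⁻¹(s(g))` at `1_{s(g)}` is meaningful. Its values lie in
`T_g G` since `g 1_{s(g)} = g`. -/
def dLeftFull (g : G) :
    TangentSpace 𝓘(ℝ, EG) (𝒢.unit (𝒢.src g)) →L[ℝ] TangentSpace 𝓘(ℝ, EG) g :=
  mfderivWithin 𝓘(ℝ, EG) 𝓘(ℝ, EG) (fun h => 𝒢.mul g h) {h | 𝒢.tgt h = 𝒢.src g}
    (𝒢.unit (𝒢.src g))

/-- The linear map `A_{s(g)} → T_g G`, `u ↦ -dL_g(d inv(u))`; note that `d inv(u)` is tangent to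
the fibre `t⁻¹(s(g))`. -/
def dLeft (g : G) : 𝒢.algebroidFiber (𝒢.src g) →ₗ[ℝ] TangentSpace 𝓘(ℝ, EG) g :=
  -((𝒢.dLeftFull g).toLinearMap ∘ₗ (𝒢.dinvUnit (𝒢.src g)).toLinearMap ∘ₗ
    (𝒢.algebroidFiber (𝒢.src g)).subtype)

/-- The right translation of a section of `⋀ᵏ A`: for `π = u₁ ∧ ⋯ ∧ uₖ` it is the wedge product of
the right-invariant vector fields of the `uᵢ`. -/
def rightTranslation {k : ℕ} (π : ∀ x : M, ⋀[ℝ]^k (𝒢.algebroidFiber x)) :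
    KVectorField 𝓘(ℝ, EG) G k :=
  fun g => exteriorPower.map k (𝒢.dRight g) (π (𝒢.tgt g))

/-- The left translation of a section of `⋀ᵏ A`: for `π = u₁ ∧ ⋯ ∧ uₖ` it is the wedge product of
the left-invariant vector fields `g ↦ -dL_g(d inv(uᵢ))`. -/
def leftTranslation {k : ℕ} (π : ∀ x : M, ⋀[ℝ]^k (𝒢.algebroidFiber x)) :
    KVectorField 𝓘(ℝ, EG) G k :=
  fun g => exteriorPower.map k (𝒢.dLeft g) (π (𝒢.src g))

/-- The space of parallelograms `(g, h, l, h g⁻¹ l)` with `s(g) = s(h)`, `t(g) = t(l)`. -/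
def parallelograms : Set (G × G × G × G) :=
  {p | ∃ g h l : G, 𝒢.src g = 𝒢.src h ∧ 𝒢.tgt g = 𝒢.tgt l ∧
    p = (g, h, l, 𝒢.mul (𝒢.mul h (𝒢.inv g)) l)}

/-- The graph `(g, h, g h)`, `s(g) = t(h)`, of the multiplication. -/
def mulGraph : Set (G × G × G) :=
  {p | ∃ g h : G, 𝒢.src g = 𝒢.tgt h ∧ p = (g, h, 𝒢.mul g h)}

/-- `Π` is affine: the space of parallelograms is coisotropic with respect to
`Π ⊕ (-1)ᵏ⁺¹ Π ⊕ (-1)ᵏ⁺¹ Π ⊕ Π`. -/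
def IsAffine {k : ℕ} (P : KVectorField 𝓘(ℝ, EG) G k) : Prop :=
  IsCoisotropic (𝓘(ℝ, EG).prod (𝓘(ℝ, EG).prod (𝓘(ℝ, EG).prod 𝓘(ℝ, EG)))) 𝒢.parallelograms
    (KVectorField.directSum _ _ P (KVectorField.directSum _ _ ((-1 : ℝ) ^ (k + 1) • P)
      (KVectorField.directSum _ _ ((-1 : ℝ) ^ (k + 1) • P) P)))

/-- `Π` is multiplicative: the graph of the multiplication is coisotropic with respect to
`Π ⊕ Π ⊕ (-1)ᵏ⁺¹ Π`. -/
def IsMultiplicative {k : ℕ} (P : KVectorField 𝓘(ℝ, EG) G k) : Prop :=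
  IsCoisotropic (𝓘(ℝ, EG).prod (𝓘(ℝ, EG).prod 𝓘(ℝ, EG))) 𝒢.mulGraph
    (KVectorField.directSum _ _ P (KVectorField.directSum _ _ P ((-1 : ℝ) ^ (k + 1) • P)))

/-- `Π_r = Π - →π`, where `π = pr_{⋀ᵏ A} (Π|_M)`. -/
def rightPart {k : ℕ} (P : KVectorField 𝓘(ℝ, EG) G k) : KVectorField 𝓘(ℝ, EG) G k :=
  P - 𝒢.rightTranslation (𝒢.algebroidComponent P)

/-- `Π_l = Π - ←π`, where `π = pr_{⋀ᵏ A} (Π|_M)`. -/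
def leftPart {k : ℕ} (P : KVectorField 𝓘(ℝ, EG) G k) : KVectorField 𝓘(ℝ, EG) G k :=
  P - 𝒢.leftTranslation (𝒢.algebroidComponent P)

end LieGroupoid

end

/-!
# Affine and multiplicative multivector fields on a Lie groupoid

A `k`-vector field `P` on `G` is a function `(ξ₁, …, ξₖ) ↦ P(ξ₁, …, ξₖ)` on `k`-tuples of covectors.
The conormal spaces of the multiplication graph form the graph of the multiplication of the
cotangent groupoid `T*G ⇉ A*` (up to the sign of the last factor), and the conormal spaces of the
space of parallelograms are the parallelograms of `T*G` (up to the signs of the two middle factors).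
With the signs in the definitions, `P` is multiplicative if and only if this function is additive
under composition of covectors (`isMultiplicative_iff`), and affine if and only if its alternating
sum over every parallelogram of covectors vanishes (`isAffine_iff`).

The target and source maps of `T*G` are `ξ ↦ ξ ∘ dR_g` and `ξ ↦ ξ ∘ (u ↦ -dL_g(d inv(u)))`. Hence
`→π` and `←π` are the pullbacks, along target and source, of the restriction of `P` to the unit
covectors, and the proof is the one for a function `F` on a groupoid: both `F - t^* F|_M` and
`F - s^* F|_M` are multiplicative if and only if `F(ξ η) = F(ξ) + F(η) - F(1_{s(ξ)})`
(`IsAdditiveUpToUnits`), which is the parallelogram identity for `(1_{s(ξ)}, ξ, η, ξ η)`;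
conversely the identity for `(ξ₁, ξ₂, ξ₃, ξ₄)` is the difference of those for `ξ₂ = ζ ξ₁` and
`ξ₄ = ζ ξ₃`, where `ζ = ξ₂ ξ₁⁻¹`. The cotangent groupoid is not constructed: its composition is the
relation `IsMulCovector`, tested on velocities of curves, and the quotient `ζ` is produced in
`IsParallelogramCovector.exists_quotient`.

All constructions of curves rest on the local sections of a submersion
(`Manifold.IsSubmersionAt.exists_local_sections`). They also extend the multiplication to a smooth
map near a composable pair, so that the translations of vectors are partial derivatives of smooth
maps; this gives the smoothness of `→π` and `←π` (`contMDiffAt_map_partialDeriv`).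
-/

noncomputable section

/-! ### Velocities of curves -/

section Velocity

variable {E : Type*} [NormedAddCommGroup E] [NormedSpace ℝ E]
  {H : Type*} [TopologicalSpace H] {I : ModelWithCorners ℝ E H}
  {X : Type*} [TopologicalSpace X] [ChartedSpace H X]
  {E' : Type*} [NormedAddCommGroup E'] [NormedSpace ℝ E']
  {H' : Type*} [TopologicalSpace H'] {I' : ModelWithCorners ℝ E' H'}
  {Y : Type*} [TopologicalSpace Y] [ChartedSpace H' Y]

/-- The velocity at time `0` of a curve `γ`, as an element of the model space `E`, which is
definitionally the tangent space at `γ 0`. Using `E` rather than `T_{γ 0} X` makes velocities of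
curves whose initial points are only propositionally equal comparable. -/
def velocity (I : ModelWithCorners ℝ E H) (γ : ℝ → X) : E :=
  mfderiv 𝓘(ℝ, ℝ) I γ 0 (1 : ℝ)

/-- `γ` passes through `x` at time `0` and is smooth there. -/
def IsCurveAt (I : ModelWithCorners ℝ E H) (γ : ℝ → X) (x : X) : Prop :=
  γ 0 = x ∧ ContMDiffAt 𝓘(ℝ, ℝ) I ∞ γ 0

/-- The differential of `f` at `x` as a map between the model spaces. -/
def modelDeriv (I : ModelWithCorners ℝ E H) (I' : ModelWithCorners ℝ E' H') (f : X → Y) (x : X) :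
    E →L[ℝ] E' :=
  mfderiv I I' f x

/-- The differential of `f` at `x` within `S` as a map between the model spaces. It is meaningful
only on velocities of curves in `S`. -/
def modelDerivWithin (I : ModelWithCorners ℝ E H) (I' : ModelWithCorners ℝ E' H') (f : X → Y)
    (S : Set X) (x : X) : E →L[ℝ] E' :=
  mfderivWithin I I' f S x

namespace IsCurveAt

variable {γ γ' : ℝ → X} {x : X}

theorem contMDiffAt (h : IsCurveAt I γ x) : ContMDiffAt 𝓘(ℝ, ℝ) I ∞ γ 0 := h.2

theorem mdifferentiableAt (h : IsCurveAt I γ x) : MDifferentiableAt 𝓘(ℝ, ℝ) I γ 0 :=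
  h.2.mdifferentiableAt (by simp)

theorem tendsto (h : IsCurveAt I γ x) : Filter.Tendsto γ (𝓝 0) (𝓝 x) := by
  have := h.2.continuousAt.tendsto
  rwa [h.1] at this

theorem congr (h : IsCurveAt I γ x) (hγ : γ' =ᶠ[𝓝 0] γ) : IsCurveAt I γ' x :=
  ⟨hγ.eq_of_nhds.trans h.1, h.2.congr_of_eventuallyEq hγ⟩

theorem comp {f : X → Y} (hf : ContMDiffAt I I' ∞ f x) (h : IsCurveAt I γ x) :
    IsCurveAt I' (fun τ => f (γ τ)) (f x) := by
  obtain ⟨rfl, h⟩ := h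
  exact ⟨rfl, hf.comp (0 : ℝ) h⟩

theorem comp_within {f : X → Y} {S : Set X} (hf : ContMDiffWithinAt I I' ∞ f S x)
    (h : IsCurveAt I γ x) (hS : ∀ᶠ τ in 𝓝 0, γ τ ∈ S) :
    IsCurveAt I' (fun τ => f (γ τ)) (f x) := by
  obtain ⟨rfl, h⟩ := h
  refine ⟨rfl, ?_⟩
  exact (ContMDiffWithinAt.comp (s := γ ⁻¹' S) (0 : ℝ) hf h.contMDiffWithinAt
    (Set.mapsTo_preimage γ S)).contMDiffAt hS

theorem prodMk {δ : ℝ → Y} {y : Y} (h : IsCurveAt I γ x) (h' : IsCurveAt I' δ y) :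
    IsCurveAt (I.prod I') (fun τ => (γ τ, δ τ)) (x, y) :=
  ⟨Prod.ext h.1 h'.1, h.2.prodMk h'.2⟩

theorem const (x : X) : IsCurveAt I (fun _ => x) x := ⟨rfl, contMDiffAt_const⟩

end IsCurveAt

variable {γ γ' : ℝ → X} {x : X}

theorem velocity_congr (h : γ =ᶠ[𝓝 0] γ') : velocity I γ = velocity I γ' := by
  unfold velocity
  have := h.mfderiv_eq (I := 𝓘(ℝ, ℝ)) (I' := I)
  exact congrArg (fun L : ℝ →L[ℝ] E => L 1) this

theorem velocity_const (x : X) : velocity I (fun _ : ℝ => x) = 0 := by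
  unfold velocity
  rw [mfderiv_const]
  rfl

theorem velocity_comp {f : X → Y} (hf : MDifferentiableAt I I' f x) (h : IsCurveAt I γ x) :
    velocity I' (fun τ => f (γ τ)) = modelDeriv I I' f x (velocity I γ) := by
  have hm := h.mdifferentiableAt
  obtain ⟨rfl, h⟩ := h
  have := mfderiv_comp (0 : ℝ) hf hm
  exact congrArg (fun L : ℝ →L[ℝ] E' => L 1) this

theorem velocity_comp_within {f : X → Y} {S : Set X} (hf : MDifferentiableWithinAt I I' f S x)
    (h : IsCurveAt I γ x) (hS : ∀ᶠ τ in 𝓝 0, γ τ ∈ S) :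
    velocity I' (fun τ => f (γ τ)) =
      modelDerivWithin I I' f S x (velocity I γ) := by
  have hm := h.mdifferentiableAt
  obtain ⟨rfl, h⟩ := h
  have h1 : HasMFDerivWithinAt 𝓘(ℝ, ℝ) I γ (γ ⁻¹' S) 0 (mfderiv 𝓘(ℝ, ℝ) I γ 0) :=
    hm.hasMFDerivAt.hasMFDerivWithinAt
  have h2 := HasMFDerivWithinAt.comp (0 : ℝ) hf.hasMFDerivWithinAt h1 subset_rfl
  have h3 := (h2.hasMFDerivAt hS).mfderiv
  exact congrArg (fun L : ℝ →L[ℝ] E' => L 1) h3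

theorem velocity_prodMk {δ : ℝ → Y} {y : Y} (h : IsCurveAt I γ x) (h' : IsCurveAt I' δ y) :
    velocity (I.prod I') (fun τ => (γ τ, δ τ)) = (velocity I γ, velocity I' δ) := by
  have := mfderiv_prodMk h.mdifferentiableAt h'.mdifferentiableAt
  exact congrArg (fun L : ℝ →L[ℝ] E × E' => L 1) this

end Velocity

/-! ### Lifting curves through submersions -/

section Boundaryless

variable {E : Type*} [NormedAddCommGroup E] [NormedSpace ℝ E]
  {X : Type*} [TopologicalSpace X] [ChartedSpace E X]
  {E' : Type*} [NormedAddCommGroup E'] [NormedSpace ℝ E']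
  {Y : Type*} [TopologicalSpace Y] [ChartedSpace E' Y]

theorem exists_curve_velocity [IsManifold 𝓘(ℝ, E) ∞ X] (x : X) (v : E) :
    ∃ γ : ℝ → X, IsCurveAt 𝓘(ℝ, E) γ x ∧ velocity 𝓘(ℝ, E) γ = v := by
  set φ := extChartAt 𝓘(ℝ, E) x with hφ
  have hc : ContMDiffAt 𝓘(ℝ, ℝ) 𝓘(ℝ, E) ∞ (fun τ : ℝ => φ x + τ • v) 0 := by
    rw [contMDiffAt_iff_contDiffAt]; fun_prop
  have hl : IsCurveAt 𝓘(ℝ, E) (fun τ : ℝ => φ x + τ • v) (φ x) := ⟨by simp, hc⟩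
  have hs : ContMDiffAt 𝓘(ℝ, E) 𝓘(ℝ, E) ∞ φ.symm (φ x) :=
    (contMDiffOn_extChartAt_symm x).contMDiffAt (extChartAt_target_mem_nhds x)
  have hx : φ.symm (φ x) = x := extChartAt_to_inv x
  have h1 : IsCurveAt 𝓘(ℝ, E) (fun τ => φ.symm (φ x + τ • v)) x := by
    have := hl.comp hs
    rwa [hx] at this
  refine ⟨_, h1, ?_⟩
  -- In the preferred chart at `x`, the differential of the chart at `x` is the identity.
  have h2 : HasMFDerivAt 𝓘(ℝ, ℝ) 𝓘(ℝ, E) (fun τ : ℝ => φ.symm (φ x + τ • v)) 0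
      (ContinuousLinearMap.toSpanSingleton ℝ v : ℝ →L[ℝ] E) := by
    refine ⟨h1.contMDiffAt.continuousAt, ?_⟩
    have hev : ∀ᶠ τ : ℝ in 𝓝 0, φ x + τ • v ∈ φ.target :=
      hl.tendsto.eventually (extChartAt_target_mem_nhds x)
    have hd : HasDerivAt (fun τ : ℝ => φ x + τ • v) v 0 := by
      simpa using ((hasDerivAt_id (0 : ℝ)).smul_const v).const_add (φ x)
    have hd' := hd.hasFDerivAt
    refine HasFDerivAt.hasFDerivWithinAt (HasFDerivAt.congr_of_eventuallyEq
      (f := fun τ : ℝ => φ x + τ • v) ?_ ?_)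
    · exact hd'
    · filter_upwards [hev] with τ hτ
      simp only [writtenInExtChartAt, Function.comp_apply, h1.1]
      exact φ.right_inv hτ
  have := h2.mfderiv
  exact (congrArg (fun L : ℝ →L[ℝ] E => L 1) this).trans (by simp)

/-- Near a point `x`, a submersion `f` has a smooth family of local sections `r (x', ·)` indexed by
the points `x'` near `x`, normalised by `r (x', f x') = x'`. In adapted charts `f` is a projection,
and `r (x', y)` has the fibre coordinate of `x'` and the base coordinate of `y`. -/
theorem Manifold.IsSubmersionAt.exists_local_sections {f : X → Y} {x : X}
    (hf : Manifold.IsSubmersionAt 𝓘(ℝ, E) 𝓘(ℝ, E') ∞ f x) :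
    ∃ r : X × Y → X, r (x, f x) = x ∧
      ContMDiffAt (𝓘(ℝ, E).prod 𝓘(ℝ, E')) 𝓘(ℝ, E) ∞ r (x, f x) ∧
      (∀ᶠ p in 𝓝 (x, f x), f (r p) = p.2) ∧ ∀ᶠ x' in 𝓝 x, r (x', f x') = x' := by
  set ψ := hf.domChart
  set χ := hf.codChart
  set e := hf.equiv
  have hxψ : x ∈ ψ.source := hf.mem_domChart_source
  have hxχ : f x ∈ χ.source := hf.mem_codChart_source
  have hw : ∀ z ∈ ψ.target, χ (f (ψ.symm z)) = (e z).1 := by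
    intro z hz
    have hz' : z ∈ (hf.domChart.extend 𝓘(ℝ, E)).target := by
      simpa [OpenPartialHomeomorph.extend] using hz
    simpa using hf.writtenInCharts hz'
  have hw' : ∀ x' ∈ ψ.source, χ (f x') = (e (ψ x')).1 := by
    intro x' hx'
    rw [← hw _ (ψ.map_source hx'), ψ.left_inv hx']
  have hsrc : ∀ z ∈ ψ.target, f (ψ.symm z) ∈ χ.source := fun z hz =>
    hf.source_subset_preimage_source (ψ.map_target hz)
  let z : X × Y → E := fun p => e.symm (χ p.2, (e (ψ p.1)).2)
  have hz : ∀ x' ∈ ψ.source, z (x', f x') = ψ x' := by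
    intro x' hx'
    simp only [z, hw' x' hx', Prod.mk.eta, ContinuousLinearEquiv.symm_apply_apply]
  have hψs : ContMDiffAt 𝓘(ℝ, E) 𝓘(ℝ, E) ∞ ψ x :=
    contMDiffAt_of_mem_maximalAtlas hf.domChart_mem_maximalAtlas hxψ
  have hχs : ContMDiffAt 𝓘(ℝ, E') 𝓘(ℝ, E') ∞ χ (f x) :=
    contMDiffAt_of_mem_maximalAtlas hf.codChart_mem_maximalAtlas hxχ
  have hψi : ContMDiffAt 𝓘(ℝ, E) 𝓘(ℝ, E) ∞ ψ.symm (ψ x) :=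
    contMDiffAt_symm_of_mem_maximalAtlas hf.domChart_mem_maximalAtlas (ψ.map_source hxψ)
  have hzs : ContMDiffAt (𝓘(ℝ, E).prod 𝓘(ℝ, E')) 𝓘(ℝ, E) ∞ z (x, f x) := by
    have h1 : ContMDiffAt (𝓘(ℝ, E).prod 𝓘(ℝ, E')) 𝓘(ℝ, E') ∞ (fun p : X × Y => χ p.2) (x, f x) :=
      hχs.comp (x, f x) contMDiffAt_snd
    have h2 : ContMDiffAt (𝓘(ℝ, E).prod 𝓘(ℝ, E')) 𝓘(ℝ, E) ∞ (fun p : X × Y => ψ p.1) (x, f x) :=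
      hψs.comp (x, f x) contMDiffAt_fst
    have h3 : ContDiff ℝ ∞ (fun q : E' × E => e.symm (q.1, (e q.2).2)) := by fun_prop
    exact h3.contMDiff.contMDiffAt.comp (x, f x) (h1.prodMk_space h2)
  have hzt : ∀ᶠ p in 𝓝 (x, f x), z p ∈ ψ.target := by
    refine hzs.continuousAt.eventually (ψ.open_target.mem_nhds ?_)
    rw [hz x hxψ]
    exact ψ.map_source hxψ
  refine ⟨fun p => ψ.symm (z p), ?_, ?_, ?_, ?_⟩
  · simp only [hz x hxψ, ψ.left_inv hxψ]
  · refine ContMDiffAt.comp (x, f x) ?_ hzs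
    rw [hz x hxψ]
    exact hψi
  · have h2 : ∀ᶠ p : X × Y in 𝓝 (x, f x), p.2 ∈ χ.source :=
      continuousAt_snd.eventually (χ.open_source.mem_nhds hxχ)
    filter_upwards [hzt, h2] with p hp hp2
    refine χ.injOn (hsrc _ hp) hp2 ?_
    rw [hw _ hp]
    simp [z]
  · filter_upwards [ψ.open_source.mem_nhds hxψ] with x' hx'
    simp only [hz x' hx', ψ.left_inv hx']

theorem Manifold.IsSubmersion.mfderiv_surjective [IsManifold 𝓘(ℝ, E') ∞ Y] {f : X → Y}
    (hf : Manifold.IsSubmersion 𝓘(ℝ, E) 𝓘(ℝ, E') ∞ f) (x : X) :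
    Function.Surjective (modelDeriv 𝓘(ℝ, E) 𝓘(ℝ, E') f x) := by
  intro w
  obtain ⟨r, hr0, hrs, hr1, -⟩ := (hf.isSubmersionAt x).exists_local_sections
  obtain ⟨c, hc, rfl⟩ := exists_curve_velocity (f x) w
  have hp := (IsCurveAt.const (I := 𝓘(ℝ, E)) x).prodMk hc
  have hb : IsCurveAt 𝓘(ℝ, E) (fun τ => r (x, c τ)) x := by
    have := hp.comp hrs
    rwa [hr0] at this
  refine ⟨velocity 𝓘(ℝ, E) (fun τ => r (x, c τ)), ?_⟩
  rw [← velocity_comp (hf.contMDiff.mdifferentiableAt (by simp)) hb]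
  exact velocity_congr (hp.tendsto.eventually hr1)

/-- A curve in the base of a submersion lifts to a curve with prescribed compatible velocity. -/
theorem Manifold.IsSubmersion.exists_lift [IsManifold 𝓘(ℝ, E) ∞ X] {f : X → Y}
    (hf : Manifold.IsSubmersion 𝓘(ℝ, E) 𝓘(ℝ, E') ∞ f) {x : X} {c : ℝ → Y}
    (hc : IsCurveAt 𝓘(ℝ, E') c (f x)) (v : E)
    (hv : modelDeriv 𝓘(ℝ, E) 𝓘(ℝ, E') f x v = velocity 𝓘(ℝ, E') c) :
    ∃ γ : ℝ → X, IsCurveAt 𝓘(ℝ, E) γ x ∧ (∀ᶠ τ in 𝓝 0, f (γ τ) = c τ) ∧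
      velocity 𝓘(ℝ, E) γ = v := by
  obtain ⟨r, hr0, hrs, hr1, hr2⟩ := (hf.isSubmersionAt x).exists_local_sections
  obtain ⟨b, hb, rfl⟩ := exists_curve_velocity x v
  have hfd : MDifferentiableAt 𝓘(ℝ, E) 𝓘(ℝ, E') f x := hf.contMDiff.mdifferentiableAt (by simp)
  have hfb : IsCurveAt 𝓘(ℝ, E') (fun τ => f (b τ)) (f x) := hb.comp hf.contMDiff.contMDiffAt
  have hp := hb.prodMk hc
  have hq := hb.prodMk hfb
  have hrd := hrs.mdifferentiableAt (by simp)
  refine ⟨fun τ => r (b τ, c τ), ?_, hp.tendsto.eventually hr1, ?_⟩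
  · have := hp.comp hrs
    rwa [hr0] at this
  -- The curves `(b, c)` and `(b, f ∘ b)` have the same velocity, and `r (b, f ∘ b) = b`.
  · rw [velocity_comp hrd hp, velocity_prodMk hb hc, ← hv, ← velocity_comp hfd hb,
      ← velocity_prodMk hb hfb, ← velocity_comp hrd hq]
    exact velocity_congr (hb.tendsto.eventually hr2)

end Boundaryless

/-! ### Evaluation on covectors and coisotropic subsets -/

section Coisotropic

variable {V W : Type*} [AddCommGroup V] [Module ℝ V] [AddCommGroup W] [Module ℝ W] {k : ℕ}

theorem kvectorEval_map (f : V →ₗ[ℝ] W) (P : ⋀[ℝ]^k V) (ξ : Fin k → Module.Dual ℝ W) :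
    kvectorEval (exteriorPower.map k f P) ξ = kvectorEval P (fun i => ξ i ∘ₗ f) := by
  have : (exteriorPower.alternatingMapToDual ℝ W k ξ) ∘ₗ exteriorPower.map k f =
      exteriorPower.alternatingMapToDual ℝ V k (fun i => ξ i ∘ₗ f) := by
    ext v
    simp [exteriorPower.alternatingMapToDual_apply_ιMulti]
  exact congrArg (fun L : ⋀[ℝ]^k V →ₗ[ℝ] ℝ => L P) this

theorem kvectorEval_neg_right (P : ⋀[ℝ]^k V) (ξ : Fin k → Module.Dual ℝ V) :
    kvectorEval P (fun i => -ξ i) = (-1) ^ k * kvectorEval P ξ := by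
  have := (exteriorPower.alternatingMapToDual ℝ V k).toMultilinearMap.map_smul_univ
    (fun _ => (-1 : ℝ)) ξ
  simp only [AlternatingMap.coe_multilinearMap, neg_smul, one_smul, Finset.prod_const,
    Finset.card_univ, Fintype.card_fin] at this
  simp [kvectorEval, this]

theorem kvectorEval_add (P Q : ⋀[ℝ]^k V) (ξ : Fin k → Module.Dual ℝ V) :
    kvectorEval (P + Q) ξ = kvectorEval P ξ + kvectorEval Q ξ := map_add _ _ _

theorem kvectorEval_sub (P Q : ⋀[ℝ]^k V) (ξ : Fin k → Module.Dual ℝ V) :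
    kvectorEval (P - Q) ξ = kvectorEval P ξ - kvectorEval Q ξ := map_sub _ _ _

theorem kvectorEval_smul (c : ℝ) (P : ⋀[ℝ]^k V) (ξ : Fin k → Module.Dual ℝ V) :
    kvectorEval (c • P) ξ = c * kvectorEval P ξ := map_smul _ _ _

variable {E : Type*} [NormedAddCommGroup E] [NormedSpace ℝ E]
  {H : Type*} [TopologicalSpace H] {I : ModelWithCorners ℝ E H}
  {X : Type*} [TopologicalSpace X] [ChartedSpace H X]
  {E' : Type*} [NormedAddCommGroup E'] [NormedSpace ℝ E']
  {H' : Type*} [TopologicalSpace H'] {I' : ModelWithCorners ℝ E' H'}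
  {Y : Type*} [TopologicalSpace Y] [ChartedSpace H' Y]

/-- The value of a `k`-vector field at `x`, as an element of `⋀ᵏ` of the model space. -/
def KVectorField.model (P : KVectorField I X k) (x : X) : ⋀[ℝ]^k E := P x

/-- The function `P_x(ξ₁, …, ξₖ)` defined by a `k`-vector field, with covectors regarded as
functionals on the model space. -/
def KVectorField.eval (P : KVectorField I X k) (x : X) (ξ : Fin k → Module.Dual ℝ E) : ℝ :=
  kvectorEval (P.model x) ξ

theorem KVectorField.eval_smul (c : ℝ) (P : KVectorField I X k) (x : X)
    (ξ : Fin k → Module.Dual ℝ E) : (c • P).eval x ξ = c * P.eval x ξ :=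
  kvectorEval_smul c (P.model x) ξ

theorem KVectorField.eval_neg_right (P : KVectorField I X k) (x : X)
    (ξ : Fin k → Module.Dual ℝ E) : P.eval x (fun i => -ξ i) = (-1) ^ k * P.eval x ξ :=
  kvectorEval_neg_right (P.model x) ξ

/-- On negated covectors, multiplication by `(-1)ᵏ⁺¹` amounts to a change of sign. -/
theorem KVectorField.eval_sign_smul_neg (P : KVectorField I X k) (x : X)
    (ξ : Fin k → Module.Dual ℝ E) :
    ((-1 : ℝ) ^ (k + 1) • P).eval x (fun i => -ξ i) = -P.eval x ξ := by
  rw [eval_smul, eval_neg_right, ← mul_assoc, ← pow_add,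
    show k + 1 + k = 2 * k + 1 by ring, pow_succ, pow_mul]
  simp

theorem kvectorEval_directSum (P : KVectorField I X k) (Q : KVectorField I' Y k) (p : X × Y)
    (ξ : Fin k → Module.Dual ℝ (TangentSpace (I.prod I') p)) :
    kvectorEval (KVectorField.directSum I I' P Q p) ξ =
      kvectorEval (P p.1) (fun i => ξ i ∘ₗ (tangentInl I I' p).toLinearMap) +
        kvectorEval (Q p.2) (fun i => ξ i ∘ₗ (tangentInr I I' p).toLinearMap) := by
  unfold KVectorField.directSum
  rw [kvectorEval_add, kvectorEval_map, kvectorEval_map]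

/-- The value of `P ⊕ Q` on the covectors `(ξ₁, ξ₂)`. -/
theorem KVectorField.eval_directSum (P : KVectorField I X k) (Q : KVectorField I' Y k)
    {x : X} {y : Y} {ξ : Fin k → Module.Dual ℝ (E × E')}
    {ξ₁ : Fin k → Module.Dual ℝ E} {ξ₂ : Fin k → Module.Dual ℝ E'}
    (h : ∀ i v w, ξ i (v, w) = ξ₁ i v + ξ₂ i w) :
    (KVectorField.directSum I I' P Q).eval (x, y) ξ = P.eval x ξ₁ + Q.eval y ξ₂ := by
  have hl : tangentInl I I' (x, y) = ContinuousLinearMap.inl ℝ E E' := mfderiv_prod_left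
  have hr : tangentInr I I' (x, y) = ContinuousLinearMap.inr ℝ E E' := mfderiv_prod_right
  have key (ζ : Fin k → Module.Dual ℝ (TangentSpace (I.prod I') (x, y)))
      (h₁ : ∀ i (v : E), ξ₁ i v = ζ i (v, (0 : E')))
      (h₂ : ∀ i (w : E'), ξ₂ i w = ζ i ((0 : E), w)) :
      (KVectorField.directSum I I' P Q).eval (x, y) ζ = P.eval x ξ₁ + Q.eval y ξ₂ := by
    have e₁ : (fun i => ζ i ∘ₗ (tangentInl I I' (x, y)).toLinearMap) = ξ₁ := by
      funext i
      refine LinearMap.ext fun v => ?_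
      exact (congrArg (fun A : E →L[ℝ] E × E' => ζ i (A v)) hl).trans (h₁ i v).symm
    have e₂ : (fun i => ζ i ∘ₗ (tangentInr I I' (x, y)).toLinearMap) = ξ₂ := by
      funext i
      refine LinearMap.ext fun v => ?_
      exact (congrArg (fun A : E' →L[ℝ] E × E' => ζ i (A v)) hr).trans (h₂ i v).symm
    rw [← e₁, ← e₂]
    exact kvectorEval_directSum P Q (x, y) ζ
  have k₁ (i : Fin k) (v : E) : ξ₁ i v = ξ i (v, 0) := by rw [h, map_zero, add_zero]
  have k₂ (i : Fin k) (w : E') : ξ₂ i w = ξ i (0, w) := by rw [h, map_zero, zero_add]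
  exact key ξ k₁ k₂

theorem mem_tangentSpaceOfSubset_dualAnnihilator {S : Set X} {x : X} 
    {ξ : Module.Dual ℝ (TangentSpace I x)} : ξ ∈ (tangentSpaceOfSubset I S x).dualAnnihilator ↔
      ∀ γ : ℝ → X, IsCurveAt I γ x → (∀ᶠ τ in 𝓝 0, γ τ ∈ S) → ξ (velocity I γ : E) = 0 := by
  rw [tangentSpaceOfSubset, Submodule.mem_dualAnnihilator]
  constructor
  · rintro h γ ⟨rfl, hγ⟩ hS
    exact h _ (Submodule.subset_span ⟨γ, rfl, hγ, hS, rfl⟩)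
  · intro h w hw
    refine Submodule.span_induction ?_ (map_zero _) ?_ ?_ hw
    · rintro _ ⟨γ, rfl, hγ, hS, rfl⟩
      exact h γ ⟨rfl, hγ⟩ hS
    · intro v w _ _ hv hw
      rw [map_add, hv, hw, add_zero]
    · intro c v _ hv
      rw [map_smul, hv, smul_zero]

theorem isCoisotropic_iff {S : Set X} {P : KVectorField I X k} :
    IsCoisotropic I S P ↔ ∀ x ∈ S, ∀ ξ : Fin k → Module.Dual ℝ E,
      (∀ i, ∀ γ : ℝ → X, IsCurveAt I γ x → (∀ᶠ τ in 𝓝 0, γ τ ∈ S) →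
        ξ i (velocity I γ) = 0) → P.eval x ξ = 0 := by
  constructor
  · intro h x hx ξ hξ
    exact h x hx ξ fun i => mem_tangentSpaceOfSubset_dualAnnihilator.2 (hξ i)
  · intro h x hx ξ hξ
    exact h x hx ξ fun i => mem_tangentSpaceOfSubset_dualAnnihilator.1 (hξ i)

end Coisotropic

namespace LieGroupoid

variable {EG : Type*} [NormedAddCommGroup EG] [NormedSpace ℝ EG]
  {EM : Type*} [NormedAddCommGroup EM] [NormedSpace ℝ EM]
  {G : Type*} [TopologicalSpace G] [ChartedSpace EG G]
  {M : Type*} [TopologicalSpace M] [ChartedSpace EM M]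
  (𝒢 : LieGroupoid EG EM G M)

/-! ### Curves and velocities in a Lie groupoid -/

theorem inv_unit (x : M) : 𝒢.inv (𝒢.unit x) = 𝒢.unit x := by
  have h := 𝒢.inv_mul (𝒢.unit x)
  have h' := 𝒢.mul_unit (𝒢.inv (𝒢.unit x))
  rw [𝒢.src_unit] at h
  rw [𝒢.src_inv, 𝒢.tgt_unit] at h'
  exact h'.symm.trans h

theorem mul_inv_mul {g h : G} (hgh : 𝒢.tgt g = 𝒢.tgt h) : 𝒢.mul g (𝒢.mul (𝒢.inv g) h) = h := by
  rw [← 𝒢.mul_assoc _ _ _ (𝒢.tgt_inv g).symm (by rw [𝒢.src_inv, hgh]), 𝒢.mul_inv, hgh,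
    𝒢.unit_mul]

theorem mul_mul_inv {g h : G} (hgh : 𝒢.src g = 𝒢.tgt h) : 𝒢.mul (𝒢.mul g h) (𝒢.inv h) = g := by
  rw [𝒢.mul_assoc _ _ _ hgh (𝒢.tgt_inv h).symm, 𝒢.mul_inv, ← hgh, 𝒢.mul_unit]

theorem mul_inv_mul_right {g h : G} (hgh : 𝒢.src g = 𝒢.src h) :
    𝒢.mul (𝒢.mul g (𝒢.inv h)) h = g := by
  rw [𝒢.mul_assoc _ _ _ (by rw [𝒢.tgt_inv, hgh]) (𝒢.src_inv h), 𝒢.inv_mul, ← hgh, 𝒢.mul_unit]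

theorem contMDiff_src : ContMDiff 𝓘(ℝ, EG) 𝓘(ℝ, EM) ∞ 𝒢.src := 𝒢.isSubmersion_src.contMDiff

theorem contMDiff_tgt : ContMDiff 𝓘(ℝ, EG) 𝓘(ℝ, EM) ∞ 𝒢.tgt := 𝒢.isSubmersion_tgt.contMDiff

/-- `ds` at `g`. -/
def dsrc (g : G) : EG →L[ℝ] EM := modelDeriv 𝓘(ℝ, EG) 𝓘(ℝ, EM) 𝒢.src g

/-- `dt` at `g`. -/
def dtgt (g : G) : EG →L[ℝ] EM := modelDeriv 𝓘(ℝ, EG) 𝓘(ℝ, EM) 𝒢.tgt g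

/-- The differential of the unit map at `x`. -/
def dunit (x : M) : EM →L[ℝ] EG := modelDeriv 𝓘(ℝ, EM) 𝓘(ℝ, EG) 𝒢.unit x

/-- The differential of the multiplication at a composable pair; it is meaningful on the pairs
`(v, w)` with `ds(v) = dt(w)`. -/
def dmul (g h : G) : EG × EG →L[ℝ] EG :=
  modelDerivWithin (𝓘(ℝ, EG).prod 𝓘(ℝ, EG)) 𝓘(ℝ, EG) (fun p : G × G => 𝒢.mul p.1 p.2)
    {p | 𝒢.src p.1 = 𝒢.tgt p.2} (g, h)

theorem velocity_src {a : ℝ → G} {g : G} (ha : IsCurveAt 𝓘(ℝ, EG) a g) :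
    velocity 𝓘(ℝ, EM) (fun τ => 𝒢.src (a τ)) = 𝒢.dsrc g (velocity 𝓘(ℝ, EG) a) :=
  velocity_comp (𝒢.contMDiff_src.mdifferentiableAt (by simp)) ha

theorem velocity_tgt {a : ℝ → G} {g : G} (ha : IsCurveAt 𝓘(ℝ, EG) a g) :
    velocity 𝓘(ℝ, EM) (fun τ => 𝒢.tgt (a τ)) = 𝒢.dtgt g (velocity 𝓘(ℝ, EG) a) :=
  velocity_comp (𝒢.contMDiff_tgt.mdifferentiableAt (by simp)) ha

theorem velocity_unit {c : ℝ → M} {x : M} (hc : IsCurveAt 𝓘(ℝ, EM) c x) :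
    velocity 𝓘(ℝ, EG) (fun τ => 𝒢.unit (c τ)) = 𝒢.dunit x (velocity 𝓘(ℝ, EM) c) :=
  velocity_comp (𝒢.contMDiff_unit.mdifferentiableAt (by simp)) hc

variable {𝒢}

theorem curve_src {a : ℝ → G} {g : G} (ha : IsCurveAt 𝓘(ℝ, EG) a g) :
    IsCurveAt 𝓘(ℝ, EM) (fun τ => 𝒢.src (a τ)) (𝒢.src g) := ha.comp 𝒢.contMDiff_src.contMDiffAt

theorem curve_tgt {a : ℝ → G} {g : G} (ha : IsCurveAt 𝓘(ℝ, EG) a g) :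
    IsCurveAt 𝓘(ℝ, EM) (fun τ => 𝒢.tgt (a τ)) (𝒢.tgt g) := ha.comp 𝒢.contMDiff_tgt.contMDiffAt

theorem curve_unit {c : ℝ → M} {x : M} (hc : IsCurveAt 𝓘(ℝ, EM) c x) :
    IsCurveAt 𝓘(ℝ, EG) (fun τ => 𝒢.unit (c τ)) (𝒢.unit x) :=
  hc.comp 𝒢.contMDiff_unit.contMDiffAt

theorem curve_inv {a : ℝ → G} {g : G} (ha : IsCurveAt 𝓘(ℝ, EG) a g) :
    IsCurveAt 𝓘(ℝ, EG) (fun τ => 𝒢.inv (a τ)) (𝒢.inv g) := ha.comp 𝒢.contMDiff_inv.contMDiffAt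

theorem composable_of_eventually {a b : ℝ → G} {g h : G} (ha : IsCurveAt 𝓘(ℝ, EG) a g)
    (hb : IsCurveAt 𝓘(ℝ, EG) b h) (hab : ∀ᶠ τ in 𝓝 0, 𝒢.src (a τ) = 𝒢.tgt (b τ)) :
    𝒢.src g = 𝒢.tgt h := by
  have := hab.self_of_nhds
  rwa [ha.1, hb.1] at this

theorem curve_mul {a b : ℝ → G} {g h : G} (ha : IsCurveAt 𝓘(ℝ, EG) a g)
    (hb : IsCurveAt 𝓘(ℝ, EG) b h) (hab : ∀ᶠ τ in 𝓝 0, 𝒢.src (a τ) = 𝒢.tgt (b τ)) :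
    IsCurveAt 𝓘(ℝ, EG) (fun τ => 𝒢.mul (a τ) (b τ)) (𝒢.mul g h) :=
  (ha.prodMk hb).comp_within
    (𝒢.contMDiffOn_mul (g, h) (composable_of_eventually ha hb hab)) hab

theorem velocity_mul {a b : ℝ → G} {g h : G} (ha : IsCurveAt 𝓘(ℝ, EG) a g)
    (hb : IsCurveAt 𝓘(ℝ, EG) b h) (hab : ∀ᶠ τ in 𝓝 0, 𝒢.src (a τ) = 𝒢.tgt (b τ)) :
    velocity 𝓘(ℝ, EG) (fun τ => 𝒢.mul (a τ) (b τ)) =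
      𝒢.dmul g h (velocity 𝓘(ℝ, EG) a, velocity 𝓘(ℝ, EG) b) := by
  rw [← velocity_prodMk ha hb]
  exact velocity_comp_within ((𝒢.contMDiffOn_mul (g, h)
    (composable_of_eventually ha hb hab)).mdifferentiableWithinAt (by simp)) (ha.prodMk hb) hab

variable (𝒢)

/-! ### Translations of vectors along the source fibres -/

/-- The `A`-component `v - d1(ds(v))` of a vector `v` at the unit `1_x`. -/
def fibrePart (x : M) (v : EG) : EG := v - 𝒢.dunit x (𝒢.dsrc (𝒢.unit x) v)

/-- The linear map `v ↦ dR_g(pr_A(v))` from `T_{1_{t(g)}} G` to `T_g G`. -/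
def rightProj (g : G) : EG →ₗ[ℝ] EG := 𝒢.dRight g ∘ₗ 𝒢.prA (𝒢.tgt g)

/-- The linear map `v ↦ -dL_g(d inv(pr_A(v)))` from `T_{1_{s(g)}} G` to `T_g G`. -/
def leftProj (g : G) : EG →ₗ[ℝ] EG := 𝒢.dLeft g ∘ₗ 𝒢.prA (𝒢.src g)

theorem rightProj_apply (g : G) (v : EG) :
    𝒢.rightProj g v = modelDerivWithin 𝓘(ℝ, EG) 𝓘(ℝ, EG) (fun h => 𝒢.mul h g)
      {h | 𝒢.src h = 𝒢.tgt g} (𝒢.unit (𝒢.tgt g)) (𝒢.fibrePart (𝒢.tgt g) v) := rfl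

theorem leftProj_apply (g : G) (v : EG) :
    𝒢.leftProj g v = -modelDerivWithin 𝓘(ℝ, EG) 𝓘(ℝ, EG) (fun h => 𝒢.mul g h)
      {h | 𝒢.tgt h = 𝒢.src g} (𝒢.unit (𝒢.src g))
      (modelDeriv 𝓘(ℝ, EG) 𝓘(ℝ, EG) 𝒢.inv (𝒢.unit (𝒢.src g)) (𝒢.fibrePart (𝒢.src g) v)) := rfl

theorem dsrc_fibrePart (x : M) (v : EG) : 𝒢.dsrc (𝒢.unit x) (𝒢.fibrePart x v) = 0 :=
  (𝒢.prA x v).2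

theorem exists_source_fibre_curve [IsManifold 𝓘(ℝ, EG) ∞ G] (x : M) (v : EG) :
    ∃ c : ℝ → G, IsCurveAt 𝓘(ℝ, EG) c (𝒢.unit x) ∧ (∀ᶠ τ in 𝓝 0, 𝒢.src (c τ) = x) ∧
      velocity 𝓘(ℝ, EG) c = 𝒢.fibrePart x v := by
  have hx : IsCurveAt 𝓘(ℝ, EM) (fun _ : ℝ => x) (𝒢.src (𝒢.unit x)) := by
    rw [𝒢.src_unit]; exact IsCurveAt.const x
  refine 𝒢.isSubmersion_src.exists_lift hx _ ?_
  rw [velocity_const]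
  exact 𝒢.dsrc_fibrePart x v

variable {𝒢}

theorem curve_mul_const {c : ℝ → G} {g h : G} (hc : IsCurveAt 𝓘(ℝ, EG) c h)
    (hs : ∀ᶠ τ in 𝓝 0, 𝒢.src (c τ) = 𝒢.tgt g) :
    IsCurveAt 𝓘(ℝ, EG) (fun τ => 𝒢.mul (c τ) g) (𝒢.mul h g) :=
  curve_mul hc (IsCurveAt.const g) hs

theorem velocity_mul_right {c : ℝ → G} {g : G} {v : EG}
    (hc : IsCurveAt 𝓘(ℝ, EG) c (𝒢.unit (𝒢.tgt g)))
    (hs : ∀ᶠ τ in 𝓝 0, 𝒢.src (c τ) = 𝒢.tgt g)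
    (hv : velocity 𝓘(ℝ, EG) c = 𝒢.fibrePart (𝒢.tgt g) v) :
    velocity 𝓘(ℝ, EG) (fun τ => 𝒢.mul (c τ) g) = 𝒢.rightProj g v := by
  have hd : ContMDiffWithinAt 𝓘(ℝ, EG) 𝓘(ℝ, EG) ∞ (fun h => 𝒢.mul h g)
      {h | 𝒢.src h = 𝒢.tgt g} (𝒢.unit (𝒢.tgt g)) :=
    ContMDiffWithinAt.comp (t := {p : G × G | 𝒢.src p.1 = 𝒢.tgt p.2})
      (g := fun p : G × G => 𝒢.mul p.1 p.2) (f := fun h => (h, g)) (𝒢.unit (𝒢.tgt g))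
      (𝒢.contMDiffOn_mul _ (𝒢.src_unit _))
      (contMDiffAt_id.prodMk contMDiffAt_const).contMDiffWithinAt (fun _ h => h)
  rw [rightProj_apply, ← hv]
  exact velocity_comp_within (hd.mdifferentiableWithinAt (by simp)) hc hs

theorem velocity_mul_left {c : ℝ → G} {g : G} {v : EG}
    (hc : IsCurveAt 𝓘(ℝ, EG) c (𝒢.unit (𝒢.src g)))
    (hs : ∀ᶠ τ in 𝓝 0, 𝒢.src (c τ) = 𝒢.src g)
    (hv : velocity 𝓘(ℝ, EG) c = 𝒢.fibrePart (𝒢.src g) v) :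
    velocity 𝓘(ℝ, EG) (fun τ => 𝒢.mul g (𝒢.inv (c τ))) = -𝒢.leftProj g v := by
  have hd : ContMDiffWithinAt 𝓘(ℝ, EG) 𝓘(ℝ, EG) ∞ (fun h => 𝒢.mul g h)
      {h | 𝒢.tgt h = 𝒢.src g} (𝒢.unit (𝒢.src g)) :=
    ContMDiffWithinAt.comp (t := {p : G × G | 𝒢.src p.1 = 𝒢.tgt p.2})
      (g := fun p : G × G => 𝒢.mul p.1 p.2) (f := fun h => (g, h)) (𝒢.unit (𝒢.src g))
      (𝒢.contMDiffOn_mul _ (𝒢.tgt_unit _).symm)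
      (contMDiffAt_const.prodMk contMDiffAt_id).contMDiffWithinAt (fun _ h => h.symm)
  have hi := curve_inv (𝒢 := 𝒢) hc
  rw [inv_unit] at hi
  rw [leftProj_apply, neg_neg, ← hv,
    ← velocity_comp (𝒢.contMDiff_inv.mdifferentiableAt (by simp)) hc]
  refine velocity_comp_within (hd.mdifferentiableWithinAt (by simp)) hi ?_
  filter_upwards [hs] with τ hτ
  exact (𝒢.tgt_inv _).trans hτ

/-- The differential of the multiplication at `(1_{t(l)}, l)`. -/
theorem dmul_unit [IsManifold 𝓘(ℝ, EG) ∞ G] {l : G} {v w : EG}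
    (hvw : 𝒢.dsrc (𝒢.unit (𝒢.tgt l)) v = 𝒢.dtgt l w) :
    𝒢.dmul (𝒢.unit (𝒢.tgt l)) l (v, w) = w + 𝒢.rightProj l v := by
  -- `(v, w)` is the sum of `(d1(dt(w)), w)`, tangent to the pairs `(1_{t(h)}, h)`,
  -- and of `(pr_A(v), 0)`.
  obtain ⟨b, hb, rfl⟩ := exists_curve_velocity l w
  obtain ⟨c, hc, hcs, hcv⟩ := 𝒢.exists_source_fibre_curve (𝒢.tgt l) v
  have h₁ := velocity_mul (𝒢 := 𝒢) (curve_unit (curve_tgt hb)) hb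
    (Filter.Eventually.of_forall fun τ => 𝒢.src_unit _)
  have h₂ := velocity_mul hc (IsCurveAt.const l) hcs
  rw [velocity_mul_right hc hcs hcv, velocity_const, hcv] at h₂
  simp only [𝒢.unit_mul] at h₁
  rw [velocity_unit 𝒢 (curve_tgt hb), velocity_tgt 𝒢 hb, ← hvw] at h₁
  rw [h₂]
  nth_rewrite 2 [h₁]
  rw [← map_add]
  congr 1
  simp [fibrePart]

end LieGroupoid

namespace LieGroupoid

variable {EG : Type*} [NormedAddCommGroup EG] [NormedSpace ℝ EG]
  {EM : Type*} [NormedAddCommGroup EM] [NormedSpace ℝ EM]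
  {G : Type*} [TopologicalSpace G] [ChartedSpace EG G]
  {M : Type*} [TopologicalSpace M] [ChartedSpace EM M]
  (𝒢 : LieGroupoid EG EM G M)

/-! ### Conormal covectors of the multiplication graph and of the parallelograms -/

/-- The covector `(ξ₁, ξ₂, -ξ₃)` annihilates the tangent space of the multiplication graph at
`(g, h, g h)`; that is, `ξ₃` is the product of `ξ₁` and `ξ₂` in the cotangent groupoid
`T*G ⇉ A*`. -/
def IsMulCovector (g h : G) (ξ₁ ξ₂ ξ₃ : Module.Dual ℝ EG) : Prop :=
  ∀ a b : ℝ → G, IsCurveAt 𝓘(ℝ, EG) a g → IsCurveAt 𝓘(ℝ, EG) b h →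
    (∀ᶠ τ in 𝓝 0, 𝒢.src (a τ) = 𝒢.tgt (b τ)) →
    ξ₃ (velocity 𝓘(ℝ, EG) fun τ => 𝒢.mul (a τ) (b τ)) =
      ξ₁ (velocity 𝓘(ℝ, EG) a) + ξ₂ (velocity 𝓘(ℝ, EG) b)

/-- The covector `(ξ₁, -ξ₂, -ξ₃, ξ₄)` annihilates the tangent space of the space of parallelograms
at `(g, h, l, h g⁻¹ l)`; that is, `(ξ₁, ξ₂, ξ₃, ξ₄)` is a parallelogram in the cotangent
groupoid. -/
def IsParallelogramCovector (g h l : G) (ξ₁ ξ₂ ξ₃ ξ₄ : Module.Dual ℝ EG) : Prop :=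
  ∀ a b c : ℝ → G, IsCurveAt 𝓘(ℝ, EG) a g → IsCurveAt 𝓘(ℝ, EG) b h → IsCurveAt 𝓘(ℝ, EG) c l →
    (∀ᶠ τ in 𝓝 0, 𝒢.src (a τ) = 𝒢.src (b τ)) → (∀ᶠ τ in 𝓝 0, 𝒢.tgt (a τ) = 𝒢.tgt (c τ)) →
    ξ₁ (velocity 𝓘(ℝ, EG) a) +
        ξ₄ (velocity 𝓘(ℝ, EG) fun τ => 𝒢.mul (𝒢.mul (b τ) (𝒢.inv (a τ))) (c τ)) =
      ξ₂ (velocity 𝓘(ℝ, EG) b) + ξ₃ (velocity 𝓘(ℝ, EG) c)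

variable {𝒢} {k : ℕ} {P : KVectorField 𝓘(ℝ, EG) G k}

theorem curve_parallelogram {a b c : ℝ → G} {g h l : G} (ha : IsCurveAt 𝓘(ℝ, EG) a g)
    (hb : IsCurveAt 𝓘(ℝ, EG) b h) (hc : IsCurveAt 𝓘(ℝ, EG) c l)
    (hab : ∀ᶠ τ in 𝓝 0, 𝒢.src (a τ) = 𝒢.src (b τ))
    (hac : ∀ᶠ τ in 𝓝 0, 𝒢.tgt (a τ) = 𝒢.tgt (c τ)) :
    IsCurveAt 𝓘(ℝ, EG) (fun τ => 𝒢.mul (𝒢.mul (b τ) (𝒢.inv (a τ))) (c τ))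
      (𝒢.mul (𝒢.mul h (𝒢.inv g)) l) := by
  have hba : ∀ᶠ τ in 𝓝 0, 𝒢.src (b τ) = 𝒢.tgt (𝒢.inv (a τ)) := by
    filter_upwards [hab] with τ hτ
    rw [𝒢.tgt_inv, hτ]
  refine curve_mul (curve_mul hb (curve_inv ha) hba) hc ?_
  filter_upwards [hba, hac] with τ hτ hτ'
  rw [𝒢.src_mul _ _ hτ, 𝒢.src_inv, hτ']

theorem apply_prodMk {V W : Type*} [AddCommGroup V] [Module ℝ V] [AddCommGroup W] [Module ℝ W]
    (ξ : Module.Dual ℝ (V × W)) (v : V) (w : W) :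
    ξ (v, w) = (ξ ∘ₗ LinearMap.inl ℝ V W) v + (ξ ∘ₗ LinearMap.inr ℝ V W) w := by
  simp [← map_add]

/-- `P` is multiplicative if and only if `(ξ₁, …, ξₖ) ↦ P(ξ₁, …, ξₖ)` is additive under the
multiplication of covectors. -/
theorem isMultiplicative_iff :
    𝒢.IsMultiplicative P ↔ ∀ g h : G, 𝒢.src g = 𝒢.tgt h →
      ∀ ξ₁ ξ₂ ξ₃ : Fin k → Module.Dual ℝ EG, (∀ i, 𝒢.IsMulCovector g h (ξ₁ i) (ξ₂ i) (ξ₃ i)) →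
        P.eval (𝒢.mul g h) ξ₃ = P.eval g ξ₁ + P.eval h ξ₂ := by
  rw [IsMultiplicative, isCoisotropic_iff]
  constructor
  · intro H g h hgh ξ₁ ξ₂ ξ₃ hξ
    have key := H (g, h, 𝒢.mul g h) ⟨g, h, hgh, rfl⟩
      (fun i => (ξ₁ i).coprod ((ξ₂ i).coprod (-ξ₃ i))) ?_
    · rw [KVectorField.eval_directSum P _ (ξ₁ := ξ₁) (ξ₂ := fun i => (ξ₂ i).coprod (-ξ₃ i))
          (fun i v w => rfl),
        KVectorField.eval_directSum P _ (ξ₁ := ξ₂) (ξ₂ := fun i => -ξ₃ i) (fun i v w => rfl),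
        KVectorField.eval_sign_smul_neg] at key
      linarith
    · intro i γ hγ hS
      have ha : IsCurveAt 𝓘(ℝ, EG) (fun τ => (γ τ).1) g := hγ.comp contMDiffAt_fst
      have hb : IsCurveAt 𝓘(ℝ, EG) (fun τ => (γ τ).2.1) h :=
        hγ.comp (contMDiffAt_fst.comp (g, h, 𝒢.mul g h) contMDiffAt_snd)
      have hab : ∀ᶠ τ in 𝓝 0, 𝒢.src (γ τ).1 = 𝒢.tgt (γ τ).2.1 := by
        filter_upwards [hS] with τ hτ
        obtain ⟨g', h', hgh', hτ'⟩ := hτ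
        rw [hτ']; exact hgh'
      have hγ' : γ =ᶠ[𝓝 0] fun τ => ((γ τ).1, (γ τ).2.1, 𝒢.mul (γ τ).1 (γ τ).2.1) := by
        filter_upwards [hS] with τ hτ
        obtain ⟨g', h', hgh', hτ'⟩ := hτ
        rw [hτ']
      rw [velocity_congr hγ', velocity_prodMk ha (hb.prodMk (curve_mul ha hb hab)),
        velocity_prodMk hb (curve_mul ha hb hab)]
      have := hξ i _ _ ha hb hab
      simp only [LinearMap.coprod_apply, LinearMap.neg_apply, this]
      ring
  · rintro H _ ⟨g, h, hgh, rfl⟩ ξ hξ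
    have key := H g h hgh (fun i => ξ i ∘ₗ LinearMap.inl ℝ EG (EG × EG))
      (fun i => ξ i ∘ₗ LinearMap.inr ℝ EG (EG × EG) ∘ₗ LinearMap.inl ℝ EG EG)
      (fun i => -(ξ i ∘ₗ LinearMap.inr ℝ EG (EG × EG) ∘ₗ LinearMap.inr ℝ EG EG)) ?_
    · rw [KVectorField.eval_directSum P _ (fun i v w => apply_prodMk (ξ i) v w),
        KVectorField.eval_directSum P _ (fun i v w => apply_prodMk (ξ i ∘ₗ _) v w)]
      have h₃ := P.eval_sign_smul_neg (𝒢.mul g h)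
        (fun i => -(ξ i ∘ₗ LinearMap.inr ℝ EG (EG × EG) ∘ₗ LinearMap.inr ℝ EG EG))
      simp only [neg_neg] at h₃
      have : P.eval g (fun i => ξ i ∘ₗ LinearMap.inl ℝ EG (EG × EG)) +
          (P.eval h (fun i => ξ i ∘ₗ LinearMap.inr ℝ EG (EG × EG) ∘ₗ LinearMap.inl ℝ EG EG) +
            ((-1 : ℝ) ^ (k + 1) • P).eval (𝒢.mul g h)
              (fun i => ξ i ∘ₗ LinearMap.inr ℝ EG (EG × EG) ∘ₗ LinearMap.inr ℝ EG EG)) = 0 := by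
        linarith
      exact this
    · intro i a b ha hb hab
      have hm := curve_mul ha hb hab
      have := hξ i (fun τ => (a τ, b τ, 𝒢.mul (a τ) (b τ))) (ha.prodMk (hb.prodMk hm)) (by
        filter_upwards [hab] with τ hτ using ⟨_, _, hτ, rfl⟩)
      rw [velocity_prodMk ha (hb.prodMk hm), velocity_prodMk hb hm] at this
      have hsplit : ∀ u v w : EG, ((u, v, w) : EG × EG × EG) =
          (u, 0, 0) + ((0, v, 0) + (0, 0, w)) := by simp
      rw [hsplit, map_add, map_add] at this
      have h' : -ξ i (0, 0, velocity 𝓘(ℝ, EG) fun τ => 𝒢.mul (a τ) (b τ)) =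
          ξ i (velocity 𝓘(ℝ, EG) a, 0, 0) + ξ i (0, velocity 𝓘(ℝ, EG) b, 0) := by linarith
      exact h'

/-- `P` is affine if and only if the alternating sum of `P(ξ₁, …, ξₖ)` over the vertices of every
parallelogram of covectors vanishes. -/
theorem isAffine_iff :
    𝒢.IsAffine P ↔ ∀ g h l : G, 𝒢.src g = 𝒢.src h → 𝒢.tgt g = 𝒢.tgt l →
      ∀ ξ₁ ξ₂ ξ₃ ξ₄ : Fin k → Module.Dual ℝ EG,
        (∀ i, 𝒢.IsParallelogramCovector g h l (ξ₁ i) (ξ₂ i) (ξ₃ i) (ξ₄ i)) →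
        P.eval g ξ₁ + P.eval (𝒢.mul (𝒢.mul h (𝒢.inv g)) l) ξ₄ = P.eval h ξ₂ + P.eval l ξ₃ := by
  rw [IsAffine, isCoisotropic_iff]
  constructor
  · intro H g h l hgh hgl ξ₁ ξ₂ ξ₃ ξ₄ hξ
    have key := H (g, h, l, 𝒢.mul (𝒢.mul h (𝒢.inv g)) l) ⟨g, h, l, hgh, hgl, rfl⟩
      (fun i => (ξ₁ i).coprod ((-ξ₂ i).coprod ((-ξ₃ i).coprod (ξ₄ i)))) ?_
    · rw [KVectorField.eval_directSum P _ (ξ₁ := ξ₁)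
          (ξ₂ := fun i => (-ξ₂ i).coprod ((-ξ₃ i).coprod (ξ₄ i))) (fun i v w => rfl),
        KVectorField.eval_directSum _ _ (ξ₁ := fun i => -ξ₂ i)
          (ξ₂ := fun i => (-ξ₃ i).coprod (ξ₄ i)) (fun i v w => rfl),
        KVectorField.eval_directSum _ P (ξ₁ := fun i => -ξ₃ i) (ξ₂ := ξ₄) (fun i v w => rfl),
        KVectorField.eval_sign_smul_neg,
        KVectorField.eval_sign_smul_neg] at key
      linarith
    · intro i γ hγ hS
      have ha : IsCurveAt 𝓘(ℝ, EG) (fun τ => (γ τ).1) g := hγ.comp contMDiffAt_fst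
      have hγ2 := hγ.comp (f := Prod.snd) contMDiffAt_snd
      have hb : IsCurveAt 𝓘(ℝ, EG) (fun τ => (γ τ).2.1) h := hγ2.comp contMDiffAt_fst
      have hγ3 := hγ2.comp (f := Prod.snd) contMDiffAt_snd
      have hc : IsCurveAt 𝓘(ℝ, EG) (fun τ => (γ τ).2.2.1) l := hγ3.comp contMDiffAt_fst
      have hab : ∀ᶠ τ in 𝓝 0, 𝒢.src (γ τ).1 = 𝒢.src (γ τ).2.1 := by
        filter_upwards [hS] with τ hτ
        obtain ⟨g', h', l', h1, h2, hτ'⟩ := hτ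
        rw [hτ']; exact h1
      have hac : ∀ᶠ τ in 𝓝 0, 𝒢.tgt (γ τ).1 = 𝒢.tgt (γ τ).2.2.1 := by
        filter_upwards [hS] with τ hτ
        obtain ⟨g', h', l', h1, h2, hτ'⟩ := hτ
        rw [hτ']; exact h2
      have hγ' : γ =ᶠ[𝓝 0] fun τ => ((γ τ).1, (γ τ).2.1, (γ τ).2.2.1,
          𝒢.mul (𝒢.mul (γ τ).2.1 (𝒢.inv (γ τ).1)) (γ τ).2.2.1) := by
        filter_upwards [hS] with τ hτ
        obtain ⟨g', h', l', h1, h2, hτ'⟩ := hτ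
        rw [hτ']
      have hd := curve_parallelogram ha hb hc hab hac
      rw [velocity_congr hγ', velocity_prodMk ha (hb.prodMk (hc.prodMk hd)),
        velocity_prodMk hb (hc.prodMk hd), velocity_prodMk hc hd]
      have := hξ i _ _ _ ha hb hc hab hac
      simp only [LinearMap.coprod_apply, LinearMap.neg_apply]
      linarith
  · rintro H _ ⟨g, h, l, hgh, hgl, rfl⟩ ξ hξ
    let i₁ := LinearMap.inl ℝ EG (EG × EG × EG)
    let i₂ := LinearMap.inr ℝ EG (EG × EG × EG) ∘ₗ LinearMap.inl ℝ EG (EG × EG)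
    let i₃ := LinearMap.inr ℝ EG (EG × EG × EG) ∘ₗ LinearMap.inr ℝ EG (EG × EG) ∘ₗ
      LinearMap.inl ℝ EG EG
    let i₄ := LinearMap.inr ℝ EG (EG × EG × EG) ∘ₗ LinearMap.inr ℝ EG (EG × EG) ∘ₗ
      LinearMap.inr ℝ EG EG
    have key := H g h l hgh hgl (fun i => ξ i ∘ₗ i₁) (fun i => -(ξ i ∘ₗ i₂))
      (fun i => -(ξ i ∘ₗ i₃)) (fun i => ξ i ∘ₗ i₄) ?_
    · rw [KVectorField.eval_directSum P _ (fun i v w => apply_prodMk (ξ i) v w),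
        KVectorField.eval_directSum _ _ (fun i v w => apply_prodMk (ξ i ∘ₗ _) v w),
        KVectorField.eval_directSum _ P (fun i v w => apply_prodMk ((ξ i ∘ₗ _) ∘ₗ _) v w)]
      have h₂ := P.eval_sign_smul_neg h (fun i => -(ξ i ∘ₗ i₂))
      have h₃ := P.eval_sign_smul_neg l (fun i => -(ξ i ∘ₗ i₃))
      simp only [neg_neg] at h₂ h₃
      have : P.eval g (fun i => ξ i ∘ₗ i₁) +
          (((-1 : ℝ) ^ (k + 1) • P).eval h (fun i => ξ i ∘ₗ i₂) +
            (((-1 : ℝ) ^ (k + 1) • P).eval l (fun i => ξ i ∘ₗ i₃) +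
              P.eval (𝒢.mul (𝒢.mul h (𝒢.inv g)) l) (fun i => ξ i ∘ₗ i₄))) = 0 := by
        linarith
      exact this
    · intro i a b c ha hb hc hab hac
      have hd := curve_parallelogram ha hb hc hab hac
      have := hξ i (fun τ => (a τ, b τ, c τ, 𝒢.mul (𝒢.mul (b τ) (𝒢.inv (a τ))) (c τ)))
        (ha.prodMk (hb.prodMk (hc.prodMk hd))) (by
          filter_upwards [hab, hac] with τ hτ hτ' using ⟨_, _, _, hτ, hτ', rfl⟩)
      rw [velocity_prodMk ha (hb.prodMk (hc.prodMk hd)), velocity_prodMk hb (hc.prodMk hd),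
        velocity_prodMk hc hd] at this
      have hsplit : ∀ u v w z : EG, ((u, v, w, z) : EG × EG × EG × EG) =
          (u, 0, 0, 0) + ((0, v, 0, 0) + ((0, 0, w, 0) + (0, 0, 0, z))) := by simp
      rw [hsplit, map_add, map_add, map_add] at this
      have h' : ξ i (velocity 𝓘(ℝ, EG) a, 0, 0, 0) + ξ i (0, 0, 0, velocity 𝓘(ℝ, EG)
            fun τ => 𝒢.mul (𝒢.mul (b τ) (𝒢.inv (a τ))) (c τ)) =
          -ξ i (0, velocity 𝓘(ℝ, EG) b, 0, 0) + -ξ i (0, 0, velocity 𝓘(ℝ, EG) c, 0) := by linarith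
      exact h'

theorem eval_rightPart (g : G) (ξ : Fin k → Module.Dual ℝ EG) :
    (𝒢.rightPart P).eval g ξ =
      P.eval g ξ - P.eval (𝒢.unit (𝒢.tgt g)) (fun i => ξ i ∘ₗ 𝒢.rightProj g) := by
  have h (ζ : Fin k → Module.Dual ℝ (TangentSpace 𝓘(ℝ, EG) g)) :
      kvectorEval (𝒢.rightPart P g) ζ = kvectorEval (P g) ζ -
        kvectorEval (P (𝒢.unit (𝒢.tgt g))) (fun i => (ζ i ∘ₗ 𝒢.dRight g) ∘ₗ 𝒢.prA (𝒢.tgt g)) := by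
    rw [← kvectorEval_map (𝒢.prA (𝒢.tgt g)), ← kvectorEval_map (𝒢.dRight g)]
    exact kvectorEval_sub _ _ _
  exact h ξ

theorem eval_leftPart (g : G) (ξ : Fin k → Module.Dual ℝ EG) :
    (𝒢.leftPart P).eval g ξ =
      P.eval g ξ - P.eval (𝒢.unit (𝒢.src g)) (fun i => ξ i ∘ₗ 𝒢.leftProj g) := by
  have h (ζ : Fin k → Module.Dual ℝ (TangentSpace 𝓘(ℝ, EG) g)) :
      kvectorEval (𝒢.leftPart P g) ζ = kvectorEval (P g) ζ -
        kvectorEval (P (𝒢.unit (𝒢.src g))) (fun i => (ζ i ∘ₗ 𝒢.dLeft g) ∘ₗ 𝒢.prA (𝒢.src g)) := by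
    rw [← kvectorEval_map (𝒢.prA (𝒢.src g)), ← kvectorEval_map (𝒢.dLeft g)]
    exact kvectorEval_sub _ _ _
  exact h ξ

end LieGroupoid

namespace LieGroupoid

variable {EG : Type*} [NormedAddCommGroup EG] [NormedSpace ℝ EG]
  {EM : Type*} [NormedAddCommGroup EM] [NormedSpace ℝ EM]
  {G : Type*} [TopologicalSpace G] [ChartedSpace EG G] [IsManifold 𝓘(ℝ, EG) ∞ G]
  {M : Type*} [TopologicalSpace M] [ChartedSpace EM M]
  {𝒢 : LieGroupoid EG EM G M} {k : ℕ} {P : KVectorField 𝓘(ℝ, EG) G k}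

/-! ### Affine and multiplicative fields -/

/-- A product of covectors has the same target in `A*` as its first factor. -/
theorem IsMulCovector.comp_rightProj_mul {g h : G} {ξ₁ ξ₂ ξ₃ : Module.Dual ℝ EG}
    (hξ : 𝒢.IsMulCovector g h ξ₁ ξ₂ ξ₃) (hgh : 𝒢.src g = 𝒢.tgt h) :
    ξ₃ ∘ₗ 𝒢.rightProj (𝒢.mul g h) = ξ₁ ∘ₗ 𝒢.rightProj g := by
  have ht := 𝒢.tgt_mul g h hgh
  ext v
  obtain ⟨c, hc, hcs, hcv⟩ := 𝒢.exists_source_fibre_curve (𝒢.tgt g) v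
  have hcg := curve_mul_const hc hcs
  rw [𝒢.unit_mul] at hcg
  have hcomp : ∀ᶠ τ in 𝓝 0, 𝒢.src (𝒢.mul (c τ) g) = 𝒢.tgt h := by
    filter_upwards [hcs] with τ hτ
    rw [𝒢.src_mul _ _ hτ, hgh]
  have key := hξ _ _ hcg (IsCurveAt.const h) hcomp
  have hassoc : (fun τ => 𝒢.mul (𝒢.mul (c τ) g) h) =ᶠ[𝓝 0] fun τ => 𝒢.mul (c τ) (𝒢.mul g h) := by
    filter_upwards [hcs] with τ hτ using 𝒢.mul_assoc _ _ _ hτ hgh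
  rw [velocity_congr hassoc, velocity_const, map_zero, add_zero,
    velocity_mul_right hc hcs hcv] at key
  rw [← ht] at hc hcs hcv
  rwa [velocity_mul_right hc hcs hcv] at key

/-- A product of covectors has the same source in `A*` as its second factor. -/
theorem IsMulCovector.comp_leftProj_mul {g h : G} {ξ₁ ξ₂ ξ₃ : Module.Dual ℝ EG}
    (hξ : 𝒢.IsMulCovector g h ξ₁ ξ₂ ξ₃) (hgh : 𝒢.src g = 𝒢.tgt h) :
    ξ₃ ∘ₗ 𝒢.leftProj (𝒢.mul g h) = ξ₂ ∘ₗ 𝒢.leftProj h := by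
  have hs := 𝒢.src_mul g h hgh
  ext v
  obtain ⟨c, hc, hcs, hcv⟩ := 𝒢.exists_source_fibre_curve (𝒢.src h) v
  have hci := curve_inv (𝒢 := 𝒢) hc
  rw [inv_unit] at hci
  have hcomp : ∀ᶠ τ in 𝓝 0, 𝒢.src h = 𝒢.tgt (𝒢.inv (c τ)) := by
    filter_upwards [hcs] with τ hτ
    rw [𝒢.tgt_inv, hτ]
  have hhc := curve_mul (IsCurveAt.const h) hci hcomp
  rw [𝒢.mul_unit] at hhc
  have hcomp' : ∀ᶠ τ in 𝓝 0, 𝒢.src g = 𝒢.tgt (𝒢.mul h (𝒢.inv (c τ))) := by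
    filter_upwards [hcomp] with τ hτ
    rw [𝒢.tgt_mul _ _ hτ, hgh]
  have key := hξ _ _ (IsCurveAt.const g) hhc hcomp'
  have hassoc : (fun τ => 𝒢.mul g (𝒢.mul h (𝒢.inv (c τ)))) =ᶠ[𝓝 0]
      fun τ => 𝒢.mul (𝒢.mul g h) (𝒢.inv (c τ)) := by
    filter_upwards [hcomp] with τ hτ using (𝒢.mul_assoc _ _ _ hgh hτ).symm
  rw [velocity_congr hassoc, velocity_const, map_zero, zero_add,
    velocity_mul_left hc hcs hcv] at key
  rw [← hs] at hc hcs hcv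
  rw [velocity_mul_left hc hcs hcv, map_neg, map_neg] at key
  exact neg_injective key

/-- Composable covectors have matching source and target in `A*`: along a curve `c` in a source
fibre the product `(g c⁻¹) (c h)` is constant. -/
theorem IsMulCovector.comp_leftProj_eq {g h : G} {ξ₁ ξ₂ ξ₃ : Module.Dual ℝ EG}
    (hξ : 𝒢.IsMulCovector g h ξ₁ ξ₂ ξ₃) (hgh : 𝒢.src g = 𝒢.tgt h) :
    ξ₁ ∘ₗ 𝒢.leftProj g = ξ₂ ∘ₗ 𝒢.rightProj h := by
  ext v
  obtain ⟨c, hc, hcs, hcv⟩ := 𝒢.exists_source_fibre_curve (𝒢.tgt h) v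
  have hch := curve_mul_const hc hcs
  rw [𝒢.unit_mul] at hch
  have hvr := velocity_mul_right hc hcs hcv
  rw [← hgh] at hc hcs hcv
  have hci := curve_inv (𝒢 := 𝒢) hc
  rw [inv_unit] at hci
  have hcomp : ∀ᶠ τ in 𝓝 0, 𝒢.src g = 𝒢.tgt (𝒢.inv (c τ)) := by
    filter_upwards [hcs] with τ hτ
    rw [𝒢.tgt_inv, hτ]
  have hgc := curve_mul (IsCurveAt.const g) hci hcomp
  rw [𝒢.mul_unit] at hgc
  have hcomp' : ∀ᶠ τ in 𝓝 0, 𝒢.src (𝒢.mul g (𝒢.inv (c τ))) = 𝒢.tgt (𝒢.mul (c τ) h) := by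
    filter_upwards [hcomp, hcs] with τ hτ hτ'
    rw [𝒢.src_mul _ _ hτ, 𝒢.src_inv, 𝒢.tgt_mul _ _ (hτ'.trans hgh)]
  have key := hξ _ _ hgc hch hcomp'
  have hconst : (fun τ => 𝒢.mul (𝒢.mul g (𝒢.inv (c τ))) (𝒢.mul (c τ) h)) =ᶠ[𝓝 0]
      fun _ => 𝒢.mul g h := by
    filter_upwards [hcomp, hcs] with τ hτ hτ'
    have h1 : 𝒢.src (c τ) = 𝒢.tgt h := hτ'.trans hgh
    rw [← 𝒢.mul_assoc _ _ _ (by rw [𝒢.src_mul _ _ hτ, 𝒢.src_inv]) h1,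
      𝒢.mul_inv_mul_right hτ'.symm]
  rw [velocity_congr hconst, velocity_const, map_zero, hvr, velocity_mul_left hc hcs hcv,
    map_neg] at key
  simp only [LinearMap.comp_apply]
  linarith

variable (𝒢 P) in
/-- The function `(ξ₁, …, ξₖ) ↦ P(ξ₁, …, ξₖ)` satisfies `P(ξ η) = P(ξ) + P(η) - P(α)` for
composable `ξ` and `η`, where the element `α` of `A*` is the source of `ξ` and target of `η`,
regarded as a conormal covector of the unit submanifold. -/
def IsAdditiveUpToUnits : Prop :=
  ∀ g h : G, 𝒢.src g = 𝒢.tgt h → ∀ ξ₁ ξ₂ ξ₃ : Fin k → Module.Dual ℝ EG,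
    (∀ i, 𝒢.IsMulCovector g h (ξ₁ i) (ξ₂ i) (ξ₃ i)) →
    P.eval (𝒢.mul g h) ξ₃ =
      P.eval g ξ₁ + P.eval h ξ₂ - P.eval (𝒢.unit (𝒢.tgt h)) (fun i => ξ₂ i ∘ₗ 𝒢.rightProj h)

theorem isMultiplicative_rightPart_iff :
    𝒢.IsMultiplicative (𝒢.rightPart P) ↔ 𝒢.IsAdditiveUpToUnits P := by
  rw [isMultiplicative_iff]
  refine forall₃_congr fun g h hgh => forall₃_congr fun ξ₁ ξ₂ ξ₃ => forall_congr' fun hξ => ?_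
  have e : (fun i => ξ₃ i ∘ₗ 𝒢.rightProj (𝒢.mul g h)) = fun i => ξ₁ i ∘ₗ 𝒢.rightProj g :=
    funext fun i => (hξ i).comp_rightProj_mul hgh
  rw [eval_rightPart, eval_rightPart, eval_rightPart, e, 𝒢.tgt_mul g h hgh]
  constructor <;> intro H <;> linarith

theorem isMultiplicative_leftPart_iff :
    𝒢.IsMultiplicative (𝒢.leftPart P) ↔ 𝒢.IsAdditiveUpToUnits P := by
  rw [isMultiplicative_iff]
  refine forall₃_congr fun g h hgh => forall₃_congr fun ξ₁ ξ₂ ξ₃ => forall_congr' fun hξ => ?_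
  have e : (fun i => ξ₃ i ∘ₗ 𝒢.leftProj (𝒢.mul g h)) = fun i => ξ₂ i ∘ₗ 𝒢.leftProj h :=
    funext fun i => (hξ i).comp_leftProj_mul hgh
  have e' : (fun i => ξ₁ i ∘ₗ 𝒢.leftProj g) = fun i => ξ₂ i ∘ₗ 𝒢.rightProj h :=
    funext fun i => (hξ i).comp_leftProj_eq hgh
  rw [eval_leftPart, eval_leftPart, eval_leftPart, e, e', 𝒢.src_mul g h hgh, hgh]
  constructor <;> intro H <;> linarith

/-- The covectors `α, ξ₁, ξ₂, ξ₁ ξ₂`, where `α` is the unit covector at the target of `ξ₂`, form a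
parallelogram. -/
theorem IsMulCovector.isParallelogramCovector {h l : G} {ξ₁ ξ₂ ξ₃ : Module.Dual ℝ EG}
    (hξ : 𝒢.IsMulCovector h l ξ₁ ξ₂ ξ₃) :
    𝒢.IsParallelogramCovector (𝒢.unit (𝒢.tgt l)) h l (ξ₂ ∘ₗ 𝒢.rightProj l) ξ₁ ξ₂ ξ₃ := by
  intro a b c ha hb hc hab hac
  have hai := curve_inv (𝒢 := 𝒢) ha
  rw [inv_unit] at hai
  have hac' : ∀ᶠ τ in 𝓝 0, 𝒢.src (𝒢.inv (a τ)) = 𝒢.tgt (c τ) := by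
    filter_upwards [hac] with τ hτ
    rw [𝒢.src_inv, hτ]
  have hd := curve_mul hai hc hac'
  rw [𝒢.unit_mul] at hd
  have had : ∀ᶠ τ in 𝓝 0, 𝒢.src (a τ) = 𝒢.tgt (𝒢.mul (𝒢.inv (a τ)) (c τ)) := by
    filter_upwards [hac'] with τ hτ
    rw [𝒢.tgt_mul _ _ hτ, 𝒢.tgt_inv]
  -- Since `c = a (a⁻¹ c)`, the velocity of `a⁻¹ c` is that of `c` minus `dR_l (pr_A a')`.
  have hvel := velocity_mul ha hd had
  have hdt : 𝒢.dsrc (𝒢.unit (𝒢.tgt l)) (velocity 𝓘(ℝ, EG) a) =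
      𝒢.dtgt l (velocity 𝓘(ℝ, EG) fun τ => 𝒢.mul (𝒢.inv (a τ)) (c τ)) := by
    rw [← velocity_src 𝒢 ha, ← velocity_tgt 𝒢 hd]
    exact velocity_congr had
  rw [dmul_unit hdt] at hvel
  have hc' : (fun τ => 𝒢.mul (a τ) (𝒢.mul (𝒢.inv (a τ)) (c τ))) =ᶠ[𝓝 0] c := by
    filter_upwards [hac] with τ hτ using 𝒢.mul_inv_mul hτ
  rw [velocity_congr hc'] at hvel
  have hbd : ∀ᶠ τ in 𝓝 0, 𝒢.src (b τ) = 𝒢.tgt (𝒢.mul (𝒢.inv (a τ)) (c τ)) := by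
    filter_upwards [had, hab] with τ hτ hτ'
    rw [← hτ, hτ']
  have key := hξ _ _ hb hd hbd
  have hassoc : (fun τ => 𝒢.mul (b τ) (𝒢.mul (𝒢.inv (a τ)) (c τ))) =ᶠ[𝓝 0]
      fun τ => 𝒢.mul (𝒢.mul (b τ) (𝒢.inv (a τ))) (c τ) := by
    filter_upwards [hab, hac'] with τ hτ hτ'
    exact (𝒢.mul_assoc _ _ _ (by rw [𝒢.tgt_inv, hτ]) hτ').symm
  rw [velocity_congr hassoc] at key
  rw [key, hvel, map_add, LinearMap.comp_apply]
  ring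

/-- In a parallelogram of covectors the quotients `ξ₂ ξ₁⁻¹` and `ξ₄ ξ₃⁻¹` exist and agree. -/
theorem IsParallelogramCovector.exists_quotient {g h l : G} {ξ₁ ξ₂ ξ₃ ξ₄ : Module.Dual ℝ EG}
    [IsManifold 𝓘(ℝ, EM) ∞ M]
    (hξ : 𝒢.IsParallelogramCovector g h l ξ₁ ξ₂ ξ₃ ξ₄) (hgh : 𝒢.src g = 𝒢.src h)
    (hgl : 𝒢.tgt g = 𝒢.tgt l) :
    ∃ η : Module.Dual ℝ EG, 𝒢.IsMulCovector (𝒢.mul h (𝒢.inv g)) g η ξ₁ ξ₂ ∧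
      𝒢.IsMulCovector (𝒢.mul h (𝒢.inv g)) l η ξ₃ ξ₄ := by
  have hhg : 𝒢.src h = 𝒢.tgt (𝒢.inv g) := by rw [𝒢.tgt_inv, hgh]
  set q := 𝒢.mul h (𝒢.inv g) with hq
  have hqs : 𝒢.src q = 𝒢.tgt g := by rw [hq, 𝒢.src_mul _ _ hhg, 𝒢.src_inv]
  have hqg : 𝒢.mul q g = h := 𝒢.mul_inv_mul_right hgh.symm
  obtain ⟨σ, hσ⟩ := (𝒢.dtgt g).toLinearMap.exists_rightInverse_of_surjective
    (LinearMap.range_eq_top.2 (𝒢.isSubmersion_tgt.mfderiv_surjective g))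
  have hσ' (w : EM) : 𝒢.dtgt g (σ w) = w := congrArg (fun L : EM →ₗ[ℝ] EM => L w) hσ
  -- A vector tangent to the target fibre of `g` is moved by left multiplication by `q`;
  -- the parallelogram through `(b, q b, l)` has constant fourth vertex `q l`.
  have hvert (w : EG) (hw : 𝒢.dtgt g w = 0) : ξ₂ (𝒢.dmul q g (0, w)) = ξ₁ w := by
    obtain ⟨b, hb, hbt, rfl⟩ := 𝒢.isSubmersion_tgt.exists_lift
      (IsCurveAt.const (𝒢.tgt g)) w (hw.trans (velocity_const _).symm)
    have hqb : ∀ᶠ τ in 𝓝 0, 𝒢.src q = 𝒢.tgt (b τ) := by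
      filter_upwards [hbt] with τ hτ
      rw [hτ, hqs]
    have hqbc := curve_mul (IsCurveAt.const q) hb hqb
    have hv := velocity_mul (IsCurveAt.const q) hb hqb
    rw [velocity_const] at hv
    rw [hqg] at hqbc
    have key := hξ b _ (fun _ => l) hb hqbc (IsCurveAt.const l)
      (by filter_upwards [hqb] with τ hτ using (𝒢.src_mul _ _ hτ).symm)
      (by filter_upwards [hbt] with τ hτ using hτ.trans hgl)
    have hconst : (fun τ => 𝒢.mul (𝒢.mul (𝒢.mul q (b τ)) (𝒢.inv (b τ))) l) =ᶠ[𝓝 0]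
        fun _ => 𝒢.mul q l := by
      filter_upwards [hqb] with τ hτ
      rw [𝒢.mul_mul_inv hτ]
    rw [velocity_congr hconst, velocity_const, velocity_const, map_zero, map_zero, hv] at key
    linarith
  let s : EG →ₗ[ℝ] EG := σ ∘ₗ (𝒢.dsrc q).toLinearMap
  let η : Module.Dual ℝ EG :=
    ξ₂ ∘ₗ (𝒢.dmul q g).toLinearMap ∘ₗ (LinearMap.id.prod s) - ξ₁ ∘ₗ s
  have hη (y : EG) : η y = ξ₂ (𝒢.dmul q g (y, s y)) - ξ₁ (s y) := rfl
  have hmul : 𝒢.IsMulCovector q g η ξ₁ ξ₂ := by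
    intro a b ha hb hab
    have hd : 𝒢.dsrc q (velocity 𝓘(ℝ, EG) a) = 𝒢.dtgt g (velocity 𝓘(ℝ, EG) b) := by
      rw [← velocity_src 𝒢 ha, ← velocity_tgt 𝒢 hb]
      exact velocity_congr hab
    rw [velocity_mul ha hb hab, hη]
    have hw : 𝒢.dtgt g (velocity 𝓘(ℝ, EG) b - s (velocity 𝓘(ℝ, EG) a)) = 0 := by
      rw [map_sub, ← hd]
      exact sub_eq_zero.2 (hσ' _).symm
    have hsplit : (velocity 𝓘(ℝ, EG) a, velocity 𝓘(ℝ, EG) b) =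
        (velocity 𝓘(ℝ, EG) a, s (velocity 𝓘(ℝ, EG) a)) +
          (0, velocity 𝓘(ℝ, EG) b - s (velocity 𝓘(ℝ, EG) a)) := by simp
    rw [hsplit, map_add, map_add, hvert _ hw, map_sub]
    ring
  refine ⟨η, hmul, ?_⟩
  intro y u hy hu hyu
  -- Lift `s ∘ y` to a curve `v` at `g` with `t ∘ v = s ∘ y` and use the parallelogram
  -- `(v, y v, u, y u)`.
  have hsy : IsCurveAt 𝓘(ℝ, EM) (fun τ => 𝒢.src (y τ)) (𝒢.tgt g) := hqs ▸ curve_src hy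
  obtain ⟨v, hv, hvt, -⟩ := 𝒢.isSubmersion_tgt.exists_lift hsy _ (hσ' _)
  have hyv : ∀ᶠ τ in 𝓝 0, 𝒢.src (y τ) = 𝒢.tgt (v τ) := hvt.mono fun τ hτ => hτ.symm
  have hyvc := curve_mul hy hv hyv
  rw [hqg] at hyvc
  have key := hξ v _ u hv hyvc hu
    (by filter_upwards [hyv] with τ hτ using (𝒢.src_mul _ _ hτ).symm)
    (by filter_upwards [hyv, hyu] with τ hτ hτ' using hτ.symm.trans hτ')
  have hcancel : (fun τ => 𝒢.mul (𝒢.mul (𝒢.mul (y τ) (v τ)) (𝒢.inv (v τ))) (u τ)) =ᶠ[𝓝 0]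
      fun τ => 𝒢.mul (y τ) (u τ) := by
    filter_upwards [hyv] with τ hτ
    rw [𝒢.mul_mul_inv hτ]
  rw [velocity_congr hcancel, hmul y v hy hv hyv] at key
  linarith

theorem isAffine_iff_isAdditiveUpToUnits [IsManifold 𝓘(ℝ, EM) ∞ M] :
    𝒢.IsAffine P ↔ 𝒢.IsAdditiveUpToUnits P := by
  rw [isAffine_iff]
  constructor
  · intro H h l hhl ξ₁ ξ₂ ξ₃ hξ
    have key := H (𝒢.unit (𝒢.tgt l)) h l (by rw [𝒢.src_unit, hhl]) (𝒢.tgt_unit _) _ _ _ _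
      fun i => (hξ i).isParallelogramCovector
    rw [inv_unit, ← hhl, 𝒢.mul_unit, hhl] at key
    linarith
  · intro H g h l hgh hgl ξ₁ ξ₂ ξ₃ ξ₄ hξ
    choose η hη₁ hη₂ using fun i => (hξ i).exists_quotient hgh hgl
    have hhg : 𝒢.src h = 𝒢.tgt (𝒢.inv g) := by rw [𝒢.tgt_inv, hgh]
    have hqs : 𝒢.src (𝒢.mul h (𝒢.inv g)) = 𝒢.tgt g := by rw [𝒢.src_mul _ _ hhg, 𝒢.src_inv]
    have key₁ := H _ _ hqs _ _ _ hη₁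
    have key₂ := H _ _ (hqs.trans hgl) _ _ _ hη₂
    have e : (fun i => ξ₁ i ∘ₗ 𝒢.rightProj g) = fun i => ξ₃ i ∘ₗ 𝒢.rightProj l :=
      funext fun i => ((hη₁ i).comp_leftProj_eq hqs).symm.trans
        ((hη₂ i).comp_leftProj_eq (hqs.trans hgl))
    rw [𝒢.mul_inv_mul_right hgh.symm, e, hgl] at key₁
    linarith

end LieGroupoid

/-! ### Smoothness of the translated fields -/

section SmoothFamilies

variable {E : Type*} [NormedAddCommGroup E] [NormedSpace ℝ E] [FiniteDimensional ℝ E]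
  {X : Type*} [TopologicalSpace X] [ChartedSpace E X] {k : ℕ}

theorem contDiff_multilinear_comp (f : MultilinearMap ℝ (fun _ : Fin k => E) ℝ) (v : Fin k → E) :
    ContDiff ℝ ∞ (fun A : E →L[ℝ] E => f (fun i => A (v i))) := by
  let β := Module.finBasis ℝ E
  have hf (A : E →L[ℝ] E) : f (fun i => A (v i)) =
      ∑ r : Fin k → Fin (Module.finrank ℝ E),
        (∏ i, β.coord (r i) (A (v i))) * f (fun i => β (r i)) := by
    have hA : (fun i => A (v i)) = fun i => ∑ j, β.coord j (A (v i)) • β j :=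
      funext fun i => (β.sum_repr (A (v i))).symm
    rw [hA, f.map_sum]
    refine Finset.sum_congr rfl fun r _ => ?_
    rw [f.map_smul_univ (fun i => β.coord (r i) (A (v i))), smul_eq_mul]
  simp only [hf]
  refine ContDiff.sum fun r _ => ContDiff.mul (contDiff_prod fun i _ => ?_) contDiff_const
  exact ((β.coord (r i)).toContinuousLinearMap ∘L ContinuousLinearMap.apply ℝ E (v i)).contDiff

/-- If the endomorphisms `L x` and the `k`-vectors `Q x` depend smoothly on `x`, so do the
`k`-vectors `(⋀ᵏ L x) (Q x)`. -/
theorem contMDiffAt_exteriorPower_map {L : X → E →L[ℝ] E} {Q : X → ⋀[ℝ]^k E} {x₀ : X}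
    (hL : ContMDiffAt 𝓘(ℝ, E) 𝓘(ℝ, E →L[ℝ] E) ∞ L x₀)
    (hQ : ∀ φ : Module.Dual ℝ (⋀[ℝ]^k E), ContMDiffAt 𝓘(ℝ, E) 𝓘(ℝ, ℝ) ∞ (fun x => φ (Q x)) x₀)
    (φ : Module.Dual ℝ (⋀[ℝ]^k E)) :
    ContMDiffAt 𝓘(ℝ, E) 𝓘(ℝ, ℝ) ∞
      (fun x => φ (exteriorPower.map k (L x).toLinearMap (Q x))) x₀ := by
  have hconst (e : ⋀[ℝ]^k E) : ContMDiffAt 𝓘(ℝ, E) 𝓘(ℝ, ℝ) ∞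
      (fun x => φ (exteriorPower.map k (L x).toLinearMap e)) x₀ := by
    have he : e ∈ Submodule.span ℝ (Set.range (exteriorPower.ιMulti ℝ k (M := E))) := by
      rw [exteriorPower.ιMulti_span]; trivial
    refine Submodule.span_induction ?_ ?_ ?_ ?_ he
    · rintro _ ⟨v, rfl⟩
      let f : MultilinearMap ℝ (fun _ : Fin k => E) ℝ :=
        (φ.compAlternatingMap (exteriorPower.ιMulti ℝ k)).toMultilinearMap
      have hf (x : X) : φ (exteriorPower.map k (L x).toLinearMap (exteriorPower.ιMulti ℝ k v)) =
          f (fun i => L x (v i)) := by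
        rw [exteriorPower.map_apply_ιMulti]
        rfl
      simp only [hf]
      exact (contDiff_multilinear_comp f v).contMDiff.contMDiffAt.comp x₀ hL
    · simpa using contMDiffAt_const
    · intro a b _ _ ha hb
      simp only [map_add]
      exact ha.add hb
    · intro c a _ ha
      simp only [map_smul, smul_eq_mul]
      exact contMDiffAt_const.mul ha
  let b := Module.finBasis ℝ (⋀[ℝ]^k E)
  have hsum (x : X) : φ (exteriorPower.map k (L x).toLinearMap (Q x)) =
      ∑ j, b.coord j (Q x) * φ (exteriorPower.map k (L x).toLinearMap (b j)) := by
    conv_lhs => rw [← b.sum_repr (Q x)]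
    simp only [map_sum, map_smul, smul_eq_mul, Module.Basis.coord_apply]
  simp only [hsum]
  exact ContMDiffAt.sum fun j _ => (hQ (b.coord j)).mul (hconst (b j))

variable [IsManifold 𝓘(ℝ, E) ∞ X]

/-- The map between model spaces underlying the trivialization of the tangent bundle over the
preferred chart at `x₀`. -/
def tangentCoord (x₀ x : X) : E →L[ℝ] E :=
  (trivializationAt E (TangentSpace 𝓘(ℝ, E) : X → Type _) x₀).continuousLinearMapAt ℝ x

/-- Let `L x : T_{u(x)} X → T_x X` be the difference of the differentials at `u x` of two smooth
families of maps `F₁ x`, `F₂ x` carrying `u x` to `x`. Then the `k`-vector field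
`x ↦ (⋀ᵏ L x) P_{u(x)}` is smooth if `P` is. -/
theorem contMDiffAt_map_partialDeriv {P : KVectorField 𝓘(ℝ, E) X k}
    (hP : IsSmoothKVectorField 𝓘(ℝ, E) P) {x₀ : X} {u : X → X}
    (hu : ContMDiffAt 𝓘(ℝ, E) 𝓘(ℝ, E) ∞ u x₀) {F₁ F₂ : X → X → X}
    (hF₁ : ContMDiffAt (𝓘(ℝ, E).prod 𝓘(ℝ, E)) 𝓘(ℝ, E) ∞ (Function.uncurry F₁) (x₀, u x₀))
    (hF₂ : ContMDiffAt (𝓘(ℝ, E).prod 𝓘(ℝ, E)) 𝓘(ℝ, E) ∞ (Function.uncurry F₂) (x₀, u x₀))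
    (h₁ : ∀ᶠ x in 𝓝 x₀, F₁ x (u x) = x) (h₂ : ∀ᶠ x in 𝓝 x₀, F₂ x (u x) = x)
    {L : ∀ x, TangentSpace 𝓘(ℝ, E) (u x) →ₗ[ℝ] TangentSpace 𝓘(ℝ, E) x}
    (hL : ∀ᶠ x in 𝓝 x₀, ∀ v : E, (L x v : E) =
      modelDeriv 𝓘(ℝ, E) 𝓘(ℝ, E) (F₁ x) (u x) v - modelDeriv 𝓘(ℝ, E) 𝓘(ℝ, E) (F₂ x) (u x) v)
    (φ : Module.Dual ℝ (⋀[ℝ]^k E)) :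
    ContMDiffAt 𝓘(ℝ, E) 𝓘(ℝ, ℝ) ∞ (fun x => φ (exteriorPower.map k
      ((trivializationAt E (TangentSpace 𝓘(ℝ, E) : X → Type _) x₀).continuousLinearMapAt
        ℝ x).toLinearMap (exteriorPower.map k (L x) (P (u x))))) x₀ := by
  have hA₁ := ContMDiffAt.mfderiv F₁ u hF₁ hu (m := ∞) (by simp)
  have hA₂ := ContMDiffAt.mfderiv F₂ u hF₂ hu (m := ∞) (by simp)
  have hQ (ψ : Module.Dual ℝ (⋀[ℝ]^k E)) := (hP (u x₀) ψ).comp x₀ hu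
  refine (contMDiffAt_exteriorPower_map (hA₁.sub hA₂) hQ φ).congr_of_eventuallyEq ?_
  have hb : ∀ᶠ x in 𝓝 x₀,
      u x ∈ (trivializationAt E (TangentSpace 𝓘(ℝ, E) : X → Type _) (u x₀)).baseSet :=
    hu.continuousAt.eventually ((trivializationAt E (TangentSpace 𝓘(ℝ, E) : X → Type _)
      (u x₀)).open_baseSet.mem_nhds (FiberBundle.mem_baseSet_trivializationAt' (u x₀)))
  have h₁₀ := h₁.self_of_nhds
  have h₂₀ := h₂.self_of_nhds
  filter_upwards [h₁, h₂, hL, hb] with x hx₁ hx₂ hLx hbx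
  let T := (trivializationAt E (TangentSpace 𝓘(ℝ, E) : X → Type _) (u x₀)).symmL ℝ (u x)
  have hin (y₀ y : X) (D : E →L[ℝ] E) (w : E) :
      ContinuousLinearMap.inCoordinates E (TangentSpace 𝓘(ℝ, E)) E (TangentSpace 𝓘(ℝ, E))
        (u x₀) (u x) y₀ y D w = tangentCoord y₀ y (D (T w)) := rfl
  have hA (F : X → X → X) (hx : F x (u x) = x) (h₀ : F x₀ (u x₀) = x₀) (w : E) :
      inTangentCoordinates 𝓘(ℝ, E) 𝓘(ℝ, E) u (fun x => F x (u x))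
        (fun x => mfderiv 𝓘(ℝ, E) 𝓘(ℝ, E) (F x) (u x)) x₀ x w =
      tangentCoord x₀ x (modelDeriv 𝓘(ℝ, E) 𝓘(ℝ, E) (F x) (u x) (T w)) :=
    (hin _ _ _ w).trans (congrArg₂
      (fun a b => tangentCoord a b (modelDeriv 𝓘(ℝ, E) 𝓘(ℝ, E) (F x) (u x) (T w))) h₀ hx)
  let C := (trivializationAt E (TangentSpace 𝓘(ℝ, E) : X → Type _) (u x₀)).continuousLinearMapAt
    ℝ (u x)
  have hTC (v : TangentSpace 𝓘(ℝ, E) (u x)) : T (C v) = v :=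
    Bundle.Trivialization.symmL_continuousLinearMapAt _ hbx v
  have hcomp : ((trivializationAt E (TangentSpace 𝓘(ℝ, E) : X → Type _) x₀).continuousLinearMapAt
      ℝ x).toLinearMap ∘ₗ L x =
      (inTangentCoordinates 𝓘(ℝ, E) 𝓘(ℝ, E) u (fun x => F₁ x (u x))
        (fun x => mfderiv 𝓘(ℝ, E) 𝓘(ℝ, E) (F₁ x) (u x)) x₀ x -
      inTangentCoordinates 𝓘(ℝ, E) 𝓘(ℝ, E) u (fun x => F₂ x (u x))
        (fun x => mfderiv 𝓘(ℝ, E) 𝓘(ℝ, E) (F₂ x) (u x)) x₀ x).toLinearMap ∘ₗ C.toLinearMap := by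
    refine LinearMap.ext fun v => ?_
    have e₁ := hA F₁ hx₁ h₁₀ (C v)
    have e₂ := hA F₂ hx₂ h₂₀ (C v)
    rw [hTC v] at e₁ e₂
    refine Eq.trans ?_ (congrArg₂ (· - ·) e₁ e₂).symm
    have hsub (a b : E) : tangentCoord x₀ x (a - b) = tangentCoord x₀ x a - tangentCoord x₀ x b :=
      map_sub _ _ _
    exact (congrArg (tangentCoord (E := E) x₀ x) (hLx v)).trans (hsub _ _)
  have := congrArg (fun A : TangentSpace 𝓘(ℝ, E) (u x) →ₗ[ℝ] E =>
    φ (exteriorPower.map k A (P (u x)))) hcomp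
  simp only [exteriorPower.map_comp] at this
  exact this

end SmoothFamilies

namespace LieGroupoid

variable {EG : Type*} [NormedAddCommGroup EG] [NormedSpace ℝ EG]
  {EM : Type*} [NormedAddCommGroup EM] [NormedSpace ℝ EM]
  {G : Type*} [TopologicalSpace G] [ChartedSpace EG G]
  {M : Type*} [TopologicalSpace M] [ChartedSpace EM M]
  (𝒢 : LieGroupoid EG EM G M)

/-- Near a composable pair the multiplication extends to a smooth map on all pairs: the first
factor is first moved to the source fibre over the target of the second factor. -/
theorem exists_local_extension_mul {g h : G} (hgh : 𝒢.src g = 𝒢.tgt h) :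
    ∃ m : G × G → G, ContMDiffAt (𝓘(ℝ, EG).prod 𝓘(ℝ, EG)) 𝓘(ℝ, EG) ∞ m (g, h) ∧
      ∀ᶠ p in 𝓝 (g, h), 𝒢.src p.1 = 𝒢.tgt p.2 → m p = 𝒢.mul p.1 p.2 := by
  obtain ⟨r, hr0, hrs, hr1, hr2⟩ := (𝒢.isSubmersion_src.isSubmersionAt g).exists_local_sections
  have ht : ContMDiffAt (𝓘(ℝ, EG).prod 𝓘(ℝ, EG)) (𝓘(ℝ, EG).prod 𝓘(ℝ, EM)) ∞
      (fun p : G × G => (p.1, 𝒢.tgt p.2)) (g, h) :=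
    contMDiffAt_fst.prodMk (𝒢.contMDiff_tgt.contMDiffAt.comp (g, h) contMDiffAt_snd)
  rw [hgh] at hr0 hrs hr1
  have hs : ContMDiffAt (𝓘(ℝ, EG).prod 𝓘(ℝ, EG)) (𝓘(ℝ, EG).prod 𝓘(ℝ, EG)) ∞
      (fun p : G × G => (r (p.1, 𝒢.tgt p.2), p.2)) (g, h) :=
    (hrs.comp (g, h) ht).prodMk contMDiffAt_snd
  have hmem : ∀ᶠ p : G × G in 𝓝 (g, h), 𝒢.src (r (p.1, 𝒢.tgt p.2)) = 𝒢.tgt p.2 :=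
    ht.continuousAt.eventually hr1
  refine ⟨fun p => 𝒢.mul (r (p.1, 𝒢.tgt p.2)) p.2, ?_, ?_⟩
  · have hm := 𝒢.contMDiffOn_mul (g, h) hgh
    have hgh' : (g, h) = (r (g, 𝒢.tgt h), h) := by rw [hr0]
    rw [hgh'] at hm
    exact (ContMDiffWithinAt.comp (s := {p : G × G | 𝒢.src (r (p.1, 𝒢.tgt p.2)) = 𝒢.tgt p.2})
      (g, h) hm hs.contMDiffWithinAt (fun p hp => hp)).contMDiffAt hmem
  · have h2 : ∀ᶠ p : G × G in 𝓝 (g, h), r (p.1, 𝒢.src p.1) = p.1 :=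
      (continuousAt_fst (p := (g, h))).eventually hr2
    filter_upwards [h2] with p hp hp'
    rw [← hp', hp]

variable {𝒢}

/-- `dF ∘ pr_A = dF - d(F ∘ 1 ∘ s)` at `1_x`. This writes the left-hand side as a difference of
differentials of globally defined maps, without reference to the fibre `A_x`. -/
theorem modelDeriv_fibrePart [IsManifold 𝓘(ℝ, EG) ∞ G] {x : M} {F : G → G}
    (hF : MDifferentiableAt 𝓘(ℝ, EG) 𝓘(ℝ, EG) F (𝒢.unit x)) (v : EG) :
    modelDeriv 𝓘(ℝ, EG) 𝓘(ℝ, EG) F (𝒢.unit x) (𝒢.fibrePart x v) =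
      modelDeriv 𝓘(ℝ, EG) 𝓘(ℝ, EG) F (𝒢.unit x) v -
        modelDeriv 𝓘(ℝ, EG) 𝓘(ℝ, EG) (fun h => F (𝒢.unit (𝒢.src h))) (𝒢.unit x) v := by
  obtain ⟨b, hb, rfl⟩ := exists_curve_velocity (𝒢.unit x) v
  have hsb := curve_src (𝒢 := 𝒢) hb
  rw [𝒢.src_unit] at hsb
  have hus : MDifferentiableAt 𝓘(ℝ, EG) 𝓘(ℝ, EG) (fun h => 𝒢.unit (𝒢.src h)) (𝒢.unit x) :=
    (𝒢.contMDiff_unit.comp 𝒢.contMDiff_src).mdifferentiableAt (by simp)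
  have hF' : MDifferentiableAt 𝓘(ℝ, EG) 𝓘(ℝ, EG) (fun h => F (𝒢.unit (𝒢.src h))) (𝒢.unit x) :=
    MDifferentiableAt.comp (g := F) (𝒢.unit x) (by rwa [𝒢.src_unit]) hus
  have h1 := velocity_comp hF' hb
  have h2 := velocity_comp hF (curve_unit hsb)
  rw [fibrePart, map_sub, ← velocity_src 𝒢 hb, ← velocity_unit 𝒢 hsb, ← h1, ← h2]

end LieGroupoid

namespace LieGroupoid

variable {EG : Type*} [NormedAddCommGroup EG] [NormedSpace ℝ EG]
  {EM : Type*} [NormedAddCommGroup EM] [NormedSpace ℝ EM]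
  {G : Type*} [TopologicalSpace G] [ChartedSpace EG G] [IsManifold 𝓘(ℝ, EG) ∞ G]
  {M : Type*} [TopologicalSpace M] [ChartedSpace EM M]
  {𝒢 : LieGroupoid EG EM G M} {k : ℕ} {P : KVectorField 𝓘(ℝ, EG) G k}

/-- If `F` agrees near `1_{t(g)}` with right translation by `g` on the source fibre, then `dF`
computes `dR_g`. -/
theorem rightProj_eq_modelDeriv {g : G} {F : G → G}
    (hF : MDifferentiableAt 𝓘(ℝ, EG) 𝓘(ℝ, EG) F (𝒢.unit (𝒢.tgt g)))
    (hFg : ∀ᶠ h in 𝓝 (𝒢.unit (𝒢.tgt g)), 𝒢.src h = 𝒢.tgt g → F h = 𝒢.mul h g) (v : EG) :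
    𝒢.rightProj g v =
      modelDeriv 𝓘(ℝ, EG) 𝓘(ℝ, EG) F (𝒢.unit (𝒢.tgt g)) (𝒢.fibrePart (𝒢.tgt g) v) := by
  obtain ⟨c, hc, hcs, hcv⟩ := 𝒢.exists_source_fibre_curve (𝒢.tgt g) v
  rw [← velocity_mul_right hc hcs hcv, ← hcv, ← velocity_comp hF hc]
  refine velocity_congr ?_
  filter_upwards [hcs, hc.tendsto.eventually hFg] with τ hτ hτ' using (hτ' hτ).symm

/-- If `F` agrees near `1_{s(g)}` with `h ↦ g h⁻¹` on the source fibre, then `-dF` computes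
`u ↦ -dL_g(d inv(u))`. -/
theorem leftProj_eq_modelDeriv {g : G} {F : G → G}
    (hF : MDifferentiableAt 𝓘(ℝ, EG) 𝓘(ℝ, EG) F (𝒢.unit (𝒢.src g)))
    (hFg : ∀ᶠ h in 𝓝 (𝒢.unit (𝒢.src g)), 𝒢.src h = 𝒢.src g → F h = 𝒢.mul g (𝒢.inv h)) (v : EG) :
    𝒢.leftProj g v =
      -modelDeriv 𝓘(ℝ, EG) 𝓘(ℝ, EG) F (𝒢.unit (𝒢.src g)) (𝒢.fibrePart (𝒢.src g) v) := by
  obtain ⟨c, hc, hcs, hcv⟩ := 𝒢.exists_source_fibre_curve (𝒢.src g) v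
  rw [← neg_neg (𝒢.leftProj g v), ← velocity_mul_left hc hcs hcv, ← hcv, ← velocity_comp hF hc]
  refine congrArg Neg.neg (velocity_congr ?_)
  filter_upwards [hcs, hc.tendsto.eventually hFg] with τ hτ hτ' using (hτ' hτ).symm

variable [FiniteDimensional ℝ EG]

/-- For the extended multiplication, `dR_g ∘ pr_A` is the difference of the differentials at
`1_{t(g)}` of `h ↦ h g` and `h ↦ 1_{s(h)} g`. -/
theorem isSmoothKVectorField_rightTranslation (hP : IsSmoothKVectorField 𝓘(ℝ, EG) P) :
    IsSmoothKVectorField 𝓘(ℝ, EG) (𝒢.rightTranslation (𝒢.algebroidComponent P)) := by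
  intro g₀ φ
  obtain ⟨m, hm, hmul⟩ := 𝒢.exists_local_extension_mul (g := 𝒢.unit (𝒢.tgt g₀)) (h := g₀)
    (𝒢.src_unit _)
  have hu : ContMDiff 𝓘(ℝ, EG) 𝓘(ℝ, EG) ∞ (fun g => 𝒢.unit (𝒢.tgt g)) :=
    𝒢.contMDiff_unit.comp 𝒢.contMDiff_tgt
  have hus : ContMDiff 𝓘(ℝ, EG) 𝓘(ℝ, EG) ∞ (fun g => 𝒢.unit (𝒢.src g)) :=
    𝒢.contMDiff_unit.comp 𝒢.contMDiff_src
  have hF₁ : ContMDiffAt (𝓘(ℝ, EG).prod 𝓘(ℝ, EG)) 𝓘(ℝ, EG) ∞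
      (Function.uncurry fun g h => m (h, g)) (g₀, 𝒢.unit (𝒢.tgt g₀)) :=
    ContMDiffAt.comp (g := m) (f := fun p : G × G => (p.2, p.1)) (g₀, 𝒢.unit (𝒢.tgt g₀)) hm
      (contMDiffAt_snd.prodMk contMDiffAt_fst)
  have hF₂ : ContMDiffAt (𝓘(ℝ, EG).prod 𝓘(ℝ, EG)) 𝓘(ℝ, EG) ∞
      (Function.uncurry fun g h => m (𝒢.unit (𝒢.src h), g)) (g₀, 𝒢.unit (𝒢.tgt g₀)) :=
    ContMDiffAt.comp (g := m) (f := fun p : G × G => (𝒢.unit (𝒢.src p.2), p.1))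
      (g₀, 𝒢.unit (𝒢.tgt g₀)) (by simpa only [𝒢.src_unit] using hm)
      ((hus.contMDiffAt.comp _ contMDiffAt_snd).prodMk contMDiffAt_fst)
  have hle : (1 : WithTop ℕ∞) ≤ ∞ := by exact_mod_cast le_top
  have hev : ∀ᶠ g in 𝓝 g₀, (∀ᶠ p in 𝓝 (𝒢.unit (𝒢.tgt g), g),
      𝒢.src p.1 = 𝒢.tgt p.2 → m p = 𝒢.mul p.1 p.2) ∧
      ContMDiffAt (𝓘(ℝ, EG).prod 𝓘(ℝ, EG)) 𝓘(ℝ, EG) 1 m (𝒢.unit (𝒢.tgt g), g) :=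
    (hu.continuous.continuousAt.prodMk continuousAt_id).eventually
      (hmul.eventually_nhds.and ((contMDiffAt_iff_contMDiffAt_nhds (by simp)).1 (hm.of_le hle)))
  have h₁ : ∀ᶠ g in 𝓝 g₀, m (𝒢.unit (𝒢.tgt g), g) = g := by
    filter_upwards [hev] with g hg
    rw [hg.1.self_of_nhds (𝒢.src_unit _), 𝒢.unit_mul]
  refine (contMDiffAt_map_partialDeriv hP hu.contMDiffAt hF₁ hF₂ h₁
    (L := fun g => 𝒢.dRight g ∘ₗ 𝒢.prA (𝒢.tgt g)) ?_ ?_ φ).congr_of_eventuallyEq ?_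
  · simpa only [𝒢.src_unit] using h₁
  · filter_upwards [hev] with g hg v
    have hd : MDifferentiableAt 𝓘(ℝ, EG) 𝓘(ℝ, EG) (fun h => m (h, g)) (𝒢.unit (𝒢.tgt g)) :=
      MDifferentiableAt.comp (g := m) (f := fun h => (h, g)) _
        (hg.2.mdifferentiableAt (by simp))
        (mdifferentiableAt_id.prodMk mdifferentiableAt_const)
    refine (rightProj_eq_modelDeriv hd ?_ v).trans (modelDeriv_fibrePart hd v)
    exact (continuousAt_id.prodMk continuousAt_const).eventually hg.1
  · refine Filter.Eventually.of_forall fun g => ?_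
    simp only [rightTranslation, algebroidComponent, exteriorPower.map_comp]
    rfl

/-- For the extended multiplication, `-dL_g ∘ d inv ∘ pr_A` is the difference of the differentials
at `1_{s(g)}` of `h ↦ g (1_{s(h)})⁻¹` and `h ↦ g h⁻¹`. -/
theorem isSmoothKVectorField_leftTranslation (hP : IsSmoothKVectorField 𝓘(ℝ, EG) P) :
    IsSmoothKVectorField 𝓘(ℝ, EG) (𝒢.leftTranslation (𝒢.algebroidComponent P)) := by
  intro g₀ φ
  obtain ⟨m, hm, hmul⟩ := 𝒢.exists_local_extension_mul (g := g₀) (h := 𝒢.unit (𝒢.src g₀))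
    (𝒢.tgt_unit _).symm
  have hus : ContMDiff 𝓘(ℝ, EG) 𝓘(ℝ, EG) ∞ (fun g => 𝒢.unit (𝒢.src g)) :=
    𝒢.contMDiff_unit.comp 𝒢.contMDiff_src
  have hF₁ : ContMDiffAt (𝓘(ℝ, EG).prod 𝓘(ℝ, EG)) 𝓘(ℝ, EG) ∞
      (Function.uncurry fun g h => m (g, 𝒢.inv h)) (g₀, 𝒢.unit (𝒢.src g₀)) :=
    ContMDiffAt.comp (g := m) (f := fun p : G × G => (p.1, 𝒢.inv p.2))
      (g₀, 𝒢.unit (𝒢.src g₀)) (by simpa only [𝒢.inv_unit] using hm)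
      (contMDiffAt_fst.prodMk (𝒢.contMDiff_inv.contMDiffAt.comp _ contMDiffAt_snd))
  have hF₂ : ContMDiffAt (𝓘(ℝ, EG).prod 𝓘(ℝ, EG)) 𝓘(ℝ, EG) ∞
      (Function.uncurry fun g h => m (g, 𝒢.inv (𝒢.unit (𝒢.src h)))) (g₀, 𝒢.unit (𝒢.src g₀)) :=
    ContMDiffAt.comp (g := m) (f := fun p : G × G => (p.1, 𝒢.inv (𝒢.unit (𝒢.src p.2))))
      (g₀, 𝒢.unit (𝒢.src g₀)) (by simpa only [𝒢.inv_unit, 𝒢.src_unit] using hm)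
      (contMDiffAt_fst.prodMk ((𝒢.contMDiff_inv.comp hus).contMDiffAt.comp _ contMDiffAt_snd))
  have hle : (1 : WithTop ℕ∞) ≤ ∞ := by exact_mod_cast le_top
  have hev : ∀ᶠ g in 𝓝 g₀, (∀ᶠ p in 𝓝 (g, 𝒢.unit (𝒢.src g)),
      𝒢.src p.1 = 𝒢.tgt p.2 → m p = 𝒢.mul p.1 p.2) ∧
      ContMDiffAt (𝓘(ℝ, EG).prod 𝓘(ℝ, EG)) 𝓘(ℝ, EG) 1 m (g, 𝒢.unit (𝒢.src g)) :=
    (continuousAt_id.prodMk hus.continuous.continuousAt).eventually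
      (hmul.eventually_nhds.and ((contMDiffAt_iff_contMDiffAt_nhds (by simp)).1 (hm.of_le hle)))
  have h₁ : ∀ᶠ g in 𝓝 g₀, m (g, 𝒢.inv (𝒢.unit (𝒢.src g))) = g := by
    filter_upwards [hev] with g hg
    rw [𝒢.inv_unit, hg.1.self_of_nhds (𝒢.tgt_unit _).symm, 𝒢.mul_unit]
  -- The sign in `u ↦ -dL_g(d inv(u))` exchanges the roles of the two families of maps.
  refine (contMDiffAt_map_partialDeriv hP hus.contMDiffAt hF₂ hF₁ ?_ h₁
    (L := fun g => 𝒢.dLeft g ∘ₗ 𝒢.prA (𝒢.src g)) ?_ φ).congr_of_eventuallyEq ?_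
  · simpa only [𝒢.src_unit] using h₁
  · filter_upwards [hev] with g hg v
    have hi : MDifferentiableAt 𝓘(ℝ, EG) (𝓘(ℝ, EG).prod 𝓘(ℝ, EG)) (fun h => (g, 𝒢.inv h))
        (𝒢.unit (𝒢.src g)) :=
      mdifferentiableAt_const.prodMk (𝒢.contMDiff_inv.mdifferentiableAt (by simp))
    have hd : MDifferentiableAt 𝓘(ℝ, EG) 𝓘(ℝ, EG) (fun h => m (g, 𝒢.inv h))
        (𝒢.unit (𝒢.src g)) :=
      MDifferentiableAt.comp (g := m) (f := fun h => (g, 𝒢.inv h)) _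
        (by rw [𝒢.inv_unit]; exact hg.2.mdifferentiableAt (by simp)) hi
    refine (leftProj_eq_modelDeriv hd ?_ v).trans
      ((congrArg Neg.neg (modelDeriv_fibrePart hd v)).trans (neg_sub _ _))
    have hc := hi.continuousAt
    simp only [ContinuousAt, inv_unit] at hc
    filter_upwards [hc.eventually hg.1] with h hh hs
    exact hh ((𝒢.tgt_inv h).trans hs).symm
  · refine Filter.Eventually.of_forall fun g => ?_
    simp only [leftTranslation, algebroidComponent, exteriorPower.map_comp]
    rfl

end LieGroupoid

theorem IsSmoothKVectorField.sub {E : Type*} [NormedAddCommGroup E] [NormedSpace ℝ E]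
    {X : Type*} [TopologicalSpace X] [ChartedSpace E X] [IsManifold 𝓘(ℝ, E) ∞ X] {k : ℕ}
    {P Q : KVectorField 𝓘(ℝ, E) X k} (hP : IsSmoothKVectorField 𝓘(ℝ, E) P)
    (hQ : IsSmoothKVectorField 𝓘(ℝ, E) Q) : IsSmoothKVectorField 𝓘(ℝ, E) (P - Q) := by
  intro x φ
  refine ((hP x φ).sub (hQ x φ)).congr_of_eventuallyEq (Filter.Eventually.of_forall fun y => ?_)
  simp only [Pi.sub_apply, map_sub]

end

theorem mainTheorem7 {EG : Type*} [NormedAddCommGroup EG] [NormedSpace ℝ EG]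
    [FiniteDimensional ℝ EG]
    {EM : Type*} [NormedAddCommGroup EM] [NormedSpace ℝ EM] [FiniteDimensional ℝ EM]
    {G : Type*} [TopologicalSpace G] [ChartedSpace EG G] [IsManifold 𝓘(ℝ, EG) ∞ G]
    {M : Type*} [TopologicalSpace M] [ChartedSpace EM M] [IsManifold 𝓘(ℝ, EM) ∞ M]
    (𝒢 : LieGroupoid EG EM G M) (k : ℕ)
    (P : KVectorField 𝓘(ℝ, EG) G k) (hP : IsSmoothKVectorField 𝓘(ℝ, EG) P) :
    (IsSmoothKVectorField 𝓘(ℝ, EG) (𝒢.rightPart P) ∧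
      IsSmoothKVectorField 𝓘(ℝ, EG) (𝒢.leftPart P)) ∧
    (𝒢.IsAffine P ↔ 𝒢.IsMultiplicative (𝒢.rightPart P)) ∧
    (𝒢.IsAffine P ↔ 𝒢.IsMultiplicative (𝒢.leftPart P)) :=
  ⟨⟨hP.sub (LieGroupoid.isSmoothKVectorField_rightTranslation hP),
      hP.sub (LieGroupoid.isSmoothKVectorField_leftTranslation hP)⟩,
    LieGroupoid.isAffine_iff_isAdditiveUpToUnits.trans
      LieGroupoid.isMultiplicative_rightPart_iff.symm,
    LieGroupoid.isAffine_iff_isAdditiveUpToUnits.trans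
      LieGroupoid.isMultiplicative_leftPart_iff.symm⟩
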